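/- Consider problems $\min_{x\in\mathbb R^d} F_0(x):=f_0(x)+g(x)$ s.t. $Ax+b=0$ (P), where $g(x)=\bar g(\bar Ax+\bar b)$. Call $x^*$ an $\epsilon$-stationary point of (P) if for some $\gamma$ both $\mathrm{dist}(0,\nabla f_0(x^*)+A^\top\gamma+\partial g(x^*))\le\epsilon$ and $\|Ax^*+b\|\le\epsilon$. For $\eta>0$ let $\mathrm{prox}_{\eta\bar g}(y)=\arg\min_{y'}\{\bar g(y')+\frac1{2\eta}\|y'-y\|^2\}$. A call to ORACLE$_2$ at $(x,y,z,\eta)$ with $\eta>0$ returns $(\nabla f_0(x),\bar Ax,Ax,\bar A^\top y,A^\top z,\mathrm{prox}_{\eta\bar g}(y))$. *Algorithm Class 2.* A first-order method (FOM) of this class, started at $(x^{(0)},y^{(0)})$, generates $(x^{(t)},y^{(t)})$, $t\ge1$, with $$x^{(t)}\in\mathrm{span}\{x^{(s)},\nabla f_0(x^{(s)}),A^\top b,A^\top Ax^{(s)},\bar A^\top\bar b,\bar A^\top\bar Ax^{(s)},\bar A^\top y^{(s)}\}_{s=0}^{t-1},\qquad y^{(t)}\in\mathrm{span}\{\xi^{(t)},\mathrm{prox}_{\eta_t\bar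 g}(\xi^{(t)})\},$$ where $\eta_t>0$ and $\xi^{(t)}\in\mathrm{span}\{\bar b,y^{(s)},\bar A\bar A^\top y^{(s)},\bar Ax^{(s)}\}_{s=0}^{t-1}$. *Instance $\mathcal P$.* Let $\epsilon>0$, $L_f>0$. Let $m_1\ge2$, $m_2\ge1$ be integers with $m_1m_2$ even, $m=3m_1m_2$, $\bar d\ge5$ an odd integer, $d=m\bar d$, and $x=(x_1,\dots,x_m)$ with $x_i\in\mathbb R^{\bar d}$. Let $J_m\in\mathbb R^{(m-1)\times m}$ have the rows $(0,\dots,0,-1,1,0,\dots,0)$, and let $\mathcal M=\{im_1: 1\le i\le 3m_2-1\}\subset\{1,\dots,m-1\}$. Put $\bar A=mL_f\,J_{\mathcal M}\otimes I_{\bar d}$ and $A=mL_f\,J_{\mathcal M^C}\otimes I_{\bar d}$, where $J_{\mathcal M}$ and $J_{\mathcal M^C}$ are the rows of $J_m$ indexed by $\mathcal M$ and by its complement. Let $b=0$, $\bar b=0$ and $\bar g(y)=\frac{\beta}{mL_f}\|y\|_1$ with $\beta>(50\pi+1+\|A\|)\sqrt m\,\epsilon$. Let $\Psi(u)=0$ for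 $u\le0$, $\Psi(u)=1-e^{-u^2}$ for $u>0$, and $\Phi(v)=4\arctan v+2\pi$. Let $\varphi(z,1)=-\Psi(1)\Phi(z_1)$ and $\varphi(z,j)=\Psi(-z_{j-1})\Phi(-z_j)-\Psi(z_{j-1})\Phi(z_j)$ for $2\le j\le\bar d$. Let $h_i(z)$ be $\varphi(z,1)+3\sum_{j=1}^{\lfloor\bar d/2\rfloor}\varphi(z,2j)$ for $1\le i\le\frac m3$, $\varphi(z,1)$ for $\frac m3<i\le\frac{2m}3$, and $\varphi(z,1)+3\sum_{j=1}^{\lfloor\bar d/2\rfloor}\varphi(z,2j+1)$ for $\frac{2m}3<i\le m$. Finally let $f_0(x)=\sum_{i=1}^m\frac{300\pi\epsilon^2}{mL_f}h_i\!\left(\frac{\sqrt m L_f x_i}{150\pi\epsilon}\right)$. **Statement.** For all $\epsilon>0$, $L_f>0$ and $\omega\in[0,\frac{150\pi\epsilon}{L_f})$ and all such $m_1,m_2,\bar d,\beta$, the instance $\mathcal P$ satisfies $\inf_xF_0(x)>-\infty$, its $f_0$ is $L_f$-smooth, and $\bar g$ is proper, lower semicontinuous and convex, with a domain that is not a singleton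 and has nonempty relative interior. Any FOM in Algorithm Class 2 that is applied to $\mathcal P$ from $(x^{(0)},y^{(0)})=(0,0)$ needs at least $$\left\lceil\frac{\kappa([\bar A;A])\,L_f\,\Delta_{F_0}}{18000\pi^2}\,\epsilon^{-2}\right\rceil$$ calls to ORACLE$_2$ to output an $x^{(t)}$ with $\|x^{(t)}-x^*\|\le\omega$ for some $\epsilon$-stationary point $x^*$ of $\mathcal P$. This holds both when every iteration is counted as one call, and when one counts the calls actually made, with oracle information on an iterate being available only through calls made after that iterate was formed. Here $\Delta_{F_0}=F_0(x^{(0)})-\inf_xF_0(x)$ and $\kappa(B)=\sqrt{\lambda_{\max}(BB^\top)/\lambda^+_{\min}(BB^\top)}$, with $\lambda^+_{\min}$ the smallest positive eigenvalue. -/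

import Mathlib

/-! # Affinely constrained composite optimization, first-order methods, and a hard instance -/

namespace AffineComposite

open scoped Matrix Kronecker

noncomputable section

/-! ## Problems `min f₀(x) + ḡ(Ā x + b̄)` subject to `A x + b = 0` -/

/-- The action of a real matrix between Euclidean spaces. -/
abbrev mv {κ ι : Type} [Fintype ι] [Fintype κ] [DecidableEq ι]
    (M : Matrix κ ι ℝ) (x : EuclideanSpace ℝ ι) : EuclideanSpace ℝ κ :=
  Matrix.toLpLin 2 2 M x

/-- The data of the problem `min_x f₀(x) + g(x)` s.t. `A x + b = 0`, with `g(x) = ḡ(Ā x + b̄)`.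
Here `x ∈ ℝ^ι`, `A` has rows `κ`, and `Ā` has rows `κb`. -/
structure Problem (ι κ κb : Type) where
  /-- the smooth part of the objective -/
  f₀ : EuclideanSpace ℝ ι → ℝ
  A : Matrix κ ι ℝ
  b : EuclideanSpace ℝ κ
  Abar : Matrix κb ι ℝ
  bbar : EuclideanSpace ℝ κb
  /-- the outer function of the regularizer, with values in `ℝ ∪ {+∞}` -/
  gbar : EuclideanSpace ℝ κb → EReal

section General

variable {ι κ κb : Type} [Fintype ι] [Fintype κ] [Fintype κb]
  [DecidableEq ι] [DecidableEq κ] [DecidableEq κb]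

/-- The regularizer `g(x) = ḡ(Ā x + b̄)`. -/
def Problem.g (P : Problem ι κ κb) (x : EuclideanSpace ℝ ι) : EReal :=
  P.gbar (mv P.Abar x + P.bbar)

/-- The objective `F₀ = f₀ + g`. -/
def Problem.F₀ (P : Problem ι κ κb) (x : EuclideanSpace ℝ ι) : EReal :=
  (P.f₀ x : EReal) + P.g x

/-- `Δ_{F₀} = F₀(x⁰) - inf_x F₀(x)`, as a real number. -/
def Problem.gap (P : Problem ι κ κb) (x0 : EuclideanSpace ℝ ι) : ℝ :=
  (P.F₀ x0 - ⨅ x, P.F₀ x).toReal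

/-- `f` is `L`-smooth: differentiable with `L`-Lipschitz gradient. -/
def IsSmoothWith (L : ℝ) (f : EuclideanSpace ℝ ι → ℝ) : Prop :=
  Differentiable ℝ f ∧ ∀ x x', ‖gradient f x - gradient f x'‖ ≤ L * ‖x - x'‖

/-- The effective domain of an extended-real-valued function. -/
def effDom (h : EuclideanSpace ℝ κ → EReal) : Set (EuclideanSpace ℝ κ) := {y | h y < ⊤}

/-- `h` is proper, lower semicontinuous and convex (its epigraph is convex). -/
def IsProperLscConvex (h : EuclideanSpace ℝ κ → EReal) : Prop :=
  (∀ y, h y ≠ ⊥) ∧ (∃ y, h y ≠ ⊤) ∧ LowerSemicontinuous h ∧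
    Convex ℝ {p : EuclideanSpace ℝ κ × ℝ | h p.1 ≤ (p.2 : EReal)}

/-- The problem class: `F₀` is bounded below, `f₀` is `L_f`-smooth, and `g = ḡ(Ā · + b̄)` with `ḡ`
proper, lower semicontinuous and convex, whose domain has nonempty relative interior and is not a
singleton. -/
structure Problem.InClass (P : Problem ι κ κb) (Lf : ℝ) : Prop where
  bddBelow : ⊥ < ⨅ x, P.F₀ x
  smooth : IsSmoothWith Lf P.f₀
  convex : IsProperLscConvex P.gbar
  relint : (intrinsicInterior ℝ (effDom P.gbar)).Nonempty
  not_singleton : ¬ ∃ y, effDom P.gbar = {y}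

/-- The convex subdifferential of an extended-real-valued function. -/
def subdiff (h : EuclideanSpace ℝ ι → EReal) (x : EuclideanSpace ℝ ι) :
    Set (EuclideanSpace ℝ ι) :=
  {v | ∀ z, h x + ((inner ℝ v (z - x) : ℝ) : EReal) ≤ h z}

/-- `x` is an `ε`-stationary point: for some multiplier `γ`, the distance from `0` to
`∇f₀(x) + Aᵀγ + ∂g(x)` and the norm of `A x + b` are at most `ε`. (The extended distance is used,
so that the distance to the empty set is `+∞`.) -/
def Problem.IsStationary (P : Problem ι κ κb) (ε : ℝ) (x : EuclideanSpace ℝ ι) : Prop :=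
  ∃ γ : EuclideanSpace ℝ κ,
    Metric.infEDist 0 ((fun v => gradient P.f₀ x + mv P.Aᵀ γ + v) '' subdiff P.g x)
      ≤ ENNReal.ofReal ε ∧
    ‖mv P.A x + P.b‖ ≤ ε

/-- `p = prox_{η h}(y)`, i.e. `p` minimizes `h(p') + ‖p' - y‖² / (2η)`. -/
def IsProx (h : EuclideanSpace ℝ κ → EReal) (η : ℝ) (y p : EuclideanSpace ℝ κ) : Prop :=
  ∀ p', h p + ((1 / (2 * η) * ‖p - y‖ ^ 2 : ℝ) : EReal)
    ≤ h p' + ((1 / (2 * η) * ‖p' - y‖ ^ 2 : ℝ) : EReal)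

/-! ## The algorithm class -/

/-- The sequence `(x⁽ᵗ⁾, y⁽ᵗ⁾)` is generated by a first-order method of the class: every iterate
lies in the indicated spans. -/
def Problem.IsAlgorithmClass2 (P : Problem ι κ κb)
    (x : ℕ → EuclideanSpace ℝ ι) (y : ℕ → EuclideanSpace ℝ κb) : Prop :=
  ∀ t, 1 ≤ t →
    x t ∈ Submodule.span ℝ (⋃ s, ⋃ (_ : s < t),
      ({x s, gradient P.f₀ (x s), mv P.Aᵀ P.b, mv P.Aᵀ (mv P.A (x s)), mv P.Abarᵀ P.bbar,
        mv P.Abarᵀ (mv P.Abar (x s)), mv P.Abarᵀ (y s)} : Set (EuclideanSpace ℝ ι))) ∧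
    ∃ (η : ℝ) (ξ p : EuclideanSpace ℝ κb), 0 < η ∧
      ξ ∈ Submodule.span ℝ (⋃ s, ⋃ (_ : s < t),
        ({P.bbar, y s, mv P.Abar (mv P.Abarᵀ (y s)), mv P.Abar (x s)} :
          Set (EuclideanSpace ℝ κb))) ∧
      IsProx P.gbar η ξ p ∧
      y t ∈ Submodule.span ℝ {ξ, p}

/-- One call to the oracle: a query `(x, y, z, η)` with `η > 0` and the six vectors returned. -/
structure OracleCall (ι κ κb : Type) where
  x : EuclideanSpace ℝ ι
  y : EuclideanSpace ℝ κb
  z : EuclideanSpace ℝ κ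
  η : ℝ
  η_pos : 0 < η
  grad : EuclideanSpace ℝ ι
  Abarx : EuclideanSpace ℝ κb
  Ax : EuclideanSpace ℝ κ
  AbarTy : EuclideanSpace ℝ ι
  ATz : EuclideanSpace ℝ ι
  prox : EuclideanSpace ℝ κb

/-- The oracle: the vectors returned are
`(∇f₀(x), Ā x, A x, Āᵀ y, Aᵀ z, prox_{η ḡ}(y))`. -/
def Problem.IsOracle2 (P : Problem ι κ κb) (c : OracleCall ι κ κb) : Prop :=
  c.grad = gradient P.f₀ c.x ∧ c.Abarx = mv P.Abar c.x ∧ c.Ax = mv P.A c.x ∧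
    c.AbarTy = mv P.Abarᵀ c.y ∧ c.ATz = mv P.Aᵀ c.z ∧ IsProx P.gbar c.η c.y c.prox

/-- The iterates `(x⁽ᵗ⁾, y⁽ᵗ⁾)` are computed from the successive oracle calls `c 0, c 1, …`, where
`N t` is the number of calls made when the `t`-th iterate is formed. Thus the calls with index
`N s ≤ k < N t` are those made between the formation of iterates `s` and `t`, and in the spans of
the algorithm class only those vectors may be used that were really returned by such a call.
The vectors `Aᵀ b` and `Āᵀ b̄`, and the first of the two multiplications in `Aᵀ A x⁽ˢ⁾`,
`Āᵀ Ā x⁽ˢ⁾` and `Ā Āᵀ y⁽ˢ⁾`, are not charged, which only favours the method. -/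
def Problem.IsComputedBy (P : Problem ι κ κb)
    (x : ℕ → EuclideanSpace ℝ ι) (y : ℕ → EuclideanSpace ℝ κb)
    (c : ℕ → OracleCall ι κ κb) (N : ℕ → ℕ) : Prop :=
  (∀ k, P.IsOracle2 (c k)) ∧ Monotone N ∧
  ∀ t, 1 ≤ t →
    x t ∈ Submodule.span ℝ
      ({mv P.Aᵀ P.b, mv P.Abarᵀ P.bbar} ∪ {v | ∃ s < t, v = x s} ∪
        {v | ∃ s < t, ∃ k, N s ≤ k ∧ k < N t ∧
          (((c k).x = x s ∧ v = (c k).grad) ∨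
            ((c k).z = mv P.A (x s) ∧ v = (c k).ATz) ∨
            ((c k).y = mv P.Abar (x s) ∧ v = (c k).AbarTy) ∨
            ((c k).y = y s ∧ v = (c k).AbarTy))}) ∧
    ∃ ξ ∈ Submodule.span ℝ
      ({P.bbar} ∪ {v | ∃ s < t, v = y s} ∪
        {v | ∃ s < t, ∃ k, N s ≤ k ∧ k < N t ∧
          (((c k).x = mv P.Abarᵀ (y s) ∧ v = (c k).Abarx) ∨
            ((c k).x = x s ∧ v = (c k).Abarx))}),
      y t ∈ Submodule.span ℝ {ξ} ∨
        ∃ k < N t, (c k).y = ξ ∧ y t ∈ Submodule.span ℝ {ξ, (c k).prox}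

/-! ## The condition number -/

/-- `κ(B) = √(λ_max(B Bᵀ) / λ⁺_min(B Bᵀ))`, with the largest and the smallest positive
eigenvalue of `B Bᵀ`. -/
def condNumber (B : Matrix κ ι ℝ) : ℝ :=
  √(sSup {μ : ℝ | Module.End.HasEigenvalue (Matrix.toLin' (B * Bᵀ)) μ} /
    sInf {μ : ℝ | 0 < μ ∧ Module.End.HasEigenvalue (Matrix.toLin' (B * Bᵀ)) μ})

/-- The spectral norm of a matrix. -/
def specNorm (B : Matrix κ ι ℝ) : ℝ :=
  ‖LinearMap.toContinuousLinearMap (Matrix.toLpLin 2 2 B)‖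

/-- The number `⌈κ([Ā; A]) L_f Δ_{F₀} / (18000 π²) · ε⁻²⌉` for a problem started at `x0`. -/
def Problem.callBound (P : Problem ι κ κb) (ε Lf : ℝ) (x0 : EuclideanSpace ℝ ι) : ℕ :=
  ⌈condNumber (Matrix.fromRows P.Abar P.A) * Lf * P.gap x0 / (18000 * Real.pi ^ 2) *
    ε ^ (-2 : ℤ)⌉₊

end General

/-! ## The hard instance -/

/-- `Ψ(u) = 0` for `u ≤ 0` and `1 - exp(-u²)` for `u > 0`. -/
def Psi (u : ℝ) : ℝ := if u ≤ 0 then 0 else 1 - Real.exp (-u ^ 2)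

/-- `Φ(v) = 4 arctan v + 2π`. -/
def Phi (v : ℝ) : ℝ := 4 * Real.arctan v + 2 * Real.pi

/-- The coordinate `[z]_j` of `z ∈ ℝ^D`, for `j = 1, …, D`. -/
def coord {D : ℕ} (z : Fin D → ℝ) (j : ℕ) : ℝ :=
  if h : 1 ≤ j ∧ j ≤ D then z ⟨j - 1, by omega⟩ else 0

/-- `φ(z, j)`, for `j = 1, …, D`. -/
def phi {D : ℕ} (z : Fin D → ℝ) (j : ℕ) : ℝ :=
  if j = 1 then -Psi 1 * Phi (coord z 1)
  else Psi (-coord z (j - 1)) * Phi (-coord z j) - Psi (coord z (j - 1)) * Phi (coord z j)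

/-- `h_i` on `ℝ^D`, with `i : Fin (3 m₁ m₂)` standing for the block number `i + 1`, so that
the three cases are the three thirds of the block numbers. -/
def hFun (m₁ m₂ : ℕ) {D : ℕ} (i : Fin (3 * m₁ * m₂)) (z : Fin D → ℝ) : ℝ :=
  if (i : ℕ) + 1 ≤ m₁ * m₂ then phi z 1 + 3 * ∑ j ∈ Finset.Icc 1 (D / 2), phi z (2 * j)
  else if (i : ℕ) + 1 ≤ 2 * (m₁ * m₂) then phi z 1
  else phi z 1 + 3 * ∑ j ∈ Finset.Icc 1 (D / 2), phi z (2 * j + 1)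

/-- `f_i(z) = (300 π ε² / (m L_f)) h_i(√m L_f z / (150 π ε))` with `m = 3 m₁ m₂`. -/
def fFun (ε Lf : ℝ) (m₁ m₂ : ℕ) {D : ℕ} (i : Fin (3 * m₁ * m₂)) (z : Fin D → ℝ) : ℝ :=
  300 * Real.pi * ε ^ 2 / (((3 * m₁ * m₂ : ℕ) : ℝ) * Lf) *
    hFun m₁ m₂ i (fun j => √((3 * m₁ * m₂ : ℕ) : ℝ) * Lf * z j / (150 * Real.pi * ε))

/-- The matrix `J_m ∈ ℝ^{(m-1) × m}` with rows `(0, …, 0, -1, 1, 0, …, 0)`. -/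
def J (m : ℕ) : Matrix (Fin (m - 1)) (Fin m) ℝ := fun r c =>
  if (c : ℕ) = r then -1 else if (c : ℕ) = r + 1 then 1 else 0

/-- The rows of `J_m`, `m = 3 m₁ m₂`, with (one-based) numbers in
`ℳ = {i m₁ | i = 1, …, 3 m₂ - 1}`. -/
abbrev RowM (m₁ m₂ : ℕ) : Type := {r : Fin (3 * m₁ * m₂ - 1) // m₁ ∣ (r : ℕ) + 1}

/-- The remaining rows of `J_m`. -/
abbrev RowMc (m₁ m₂ : ℕ) : Type := {r : Fin (3 * m₁ * m₂ - 1) // ¬ m₁ ∣ (r : ℕ) + 1}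

/-- `A = m L_f · J_{ℳᶜ} ⊗ I`. -/
def hardA (Lf : ℝ) (m₁ m₂ D : ℕ) :
    Matrix (RowMc m₁ m₂ × Fin D) (Fin (3 * m₁ * m₂) × Fin D) ℝ :=
  (((3 * m₁ * m₂ : ℕ) : ℝ) * Lf) •
    (((J (3 * m₁ * m₂)).submatrix Subtype.val id) ⊗ₖ (1 : Matrix (Fin D) (Fin D) ℝ))

/-- `Ā = m L_f · J_ℳ ⊗ I`. -/
def hardAbar (Lf : ℝ) (m₁ m₂ D : ℕ) :
    Matrix (RowM m₁ m₂ × Fin D) (Fin (3 * m₁ * m₂) × Fin D) ℝ :=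
  (((3 * m₁ * m₂ : ℕ) : ℝ) * Lf) •
    (((J (3 * m₁ * m₂)).submatrix Subtype.val id) ⊗ₖ (1 : Matrix (Fin D) (Fin D) ℝ))

/-- The instance `𝒫`: `f₀(x) = ∑ᵢ f_i(x_i)` for `x = (x₁, …, x_m)` with blocks in `ℝ^D`,
`ḡ = (β / (m L_f)) ‖·‖₁`, the matrices `A`, `Ā` above, and `b = 0`, `b̄ = 0`. -/
def hardInstance (ε Lf β : ℝ) (m₁ m₂ D : ℕ) :
    Problem (Fin (3 * m₁ * m₂) × Fin D) (RowMc m₁ m₂ × Fin D) (RowM m₁ m₂ × Fin D) where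
  f₀ x := ∑ i, fFun ε Lf m₁ m₂ i (fun j => x (i, j))
  A := hardA Lf m₁ m₂ D
  b := 0
  Abar := hardAbar Lf m₁ m₂ D
  bbar := 0
  gbar y := ((β / (((3 * m₁ * m₂ : ℕ) : ℝ) * Lf) * ∑ k, |y k| : ℝ) : EReal)

end

end AffineComposite

/-! Write `M = m₁ m₂` and `m = 3M`. The proof shows that every coordinate of an `ε`-stationary point
is large in every block, while an iterate with too few steps behind it has last coordinate zero in
all blocks.

Each `h_i` is a weighted sum of links `link u v` between consecutive coordinates, with a virtual
coordinate `1` in front. The derivatives of a link vanish at `u = 0`, so a gradient can only turn on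
the coordinate next to one that is already nonzero, and only in a block that carries this link.
After the first link, even links live in the first third of the blocks and odd ones in the last
third. Multiplying by `Aᵀ A` or `Āᵀ Ā` moves information by one block, and the prox of an `ℓ¹` norm
creates no new nonzero entry. Each new coordinate therefore has to cross the middle third, and the
last one takes at least `(D - 2) M` steps (`arrival`, `arrival_le_of_weight_ne_zero`,
`hardGrad_mem_reached`).

At a stationary point `β` is so large that the regularizer must vanish (`eq_of_isStationary`). With
`‖A x‖ ≤ ε` all blocks then nearly agree (`abs_sub_le_of_isStationary`). Moving all blocks together
costs nothing in `A` or `Ā`, so the block-averaged gradient must be small. Averaged over the blocks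
every link has weight one, and a small coordinate after a large one makes the average too negative;
induction along the chain gives `one_le_abs_of_isStationary`. Summed over the `m` blocks, the last
coordinate alone gives distance at least `150πε / Lf > ω` from any unreached vector.

Finally `κ ≤ 2m` (`condNumber_le`, a discrete Poincaré inequality) and the gap is at most `1200π²ε²D
/ Lf`, so the claimed number is at most `(2/5) D M ≤ (D - 2) M` (`callBound_hardInstance`). -/

namespace AffineComposite

open scoped Matrix Kronecker

noncomputable section

/-! ## The scalar functions -/

/-- The derivative of `Psi`. -/
def dPsi (u : ℝ) : ℝ := 2 * max u 0 * Real.exp (-(max u 0) ^ 2)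

/-- The derivative of `Phi`. -/
def dPhi (v : ℝ) : ℝ := 4 / (1 + v ^ 2)

/-- Removes the case split: `(max u 0) ^ 2` is differentiable everywhere, also at `0`. -/
lemma Psi_eq (u : ℝ) : Psi u = 1 - Real.exp (-(max u 0) ^ 2) := by
  unfold Psi
  split_ifs with h
  · simp [max_eq_right h]
  · rw [max_eq_left (le_of_lt (not_le.mp h))]

lemma hasDerivAt_sq_max (u : ℝ) : HasDerivAt (fun u : ℝ => (max u 0) ^ 2) (2 * max u 0) u := by
  rcases lt_trichotomy u 0 with h | h | h
  · have h1 : (fun u : ℝ => (max u 0) ^ 2) =ᶠ[nhds u] fun _ => 0 := by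
      filter_upwards [gt_mem_nhds h] with v hv
      simp [max_eq_right hv.le]
    simpa [max_eq_right h.le] using (hasDerivAt_const u (0 : ℝ)).congr_of_eventuallyEq h1
  · subst h
    rw [hasDerivAt_iff_isLittleO_nhds_zero]
    simp only [zero_add, max_self, mul_zero, smul_zero, sub_zero, ne_eq, OfNat.ofNat_ne_zero,
      not_false_eq_true, zero_pow]
    refine Asymptotics.IsBigO.trans_isLittleO (g := fun x : ℝ => x ^ 2) ?_ ?_
    · refine Asymptotics.IsBigO.of_bound 1 (Filter.Eventually.of_forall fun x => ?_)
      rw [one_mul, Real.norm_eq_abs, Real.norm_eq_abs, abs_of_nonneg (sq_nonneg _),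
        abs_of_nonneg (sq_nonneg _)]
      rcases le_total x 0 with hx | hx
      · simp [max_eq_right hx, sq_nonneg]
      · simp [max_eq_left hx]
    · simpa using Asymptotics.isLittleO_pow_id (one_lt_two)
  · have h1 : (fun u : ℝ => (max u 0) ^ 2) =ᶠ[nhds u] fun u => u ^ 2 := by
      filter_upwards [lt_mem_nhds h] with v hv
      simp [max_eq_left (le_of_lt hv)]
    simpa [max_eq_left h.le] using (hasDerivAt_pow 2 u).congr_of_eventuallyEq h1

lemma hasDerivAt_Psi (u : ℝ) : HasDerivAt Psi (dPsi u) u := by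
  have h : HasDerivAt (fun u : ℝ => 1 - Real.exp (-(max u 0) ^ 2)) _ u :=
    ((hasDerivAt_sq_max u).neg.exp).const_sub 1
  have e : Psi = fun u : ℝ => 1 - Real.exp (-(max u 0) ^ 2) := funext Psi_eq
  rw [e]
  convert h using 1
  unfold dPsi
  simp only [Pi.neg_apply]
  ring

lemma hasDerivAt_Phi (v : ℝ) : HasDerivAt Phi (dPhi v) v := by
  have h : HasDerivAt (fun v : ℝ => 4 * Real.arctan v + 2 * Real.pi) _ v :=
    ((Real.hasDerivAt_arctan v).const_mul 4).add_const (2 * Real.pi)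
  have e : Phi = fun v : ℝ => 4 * Real.arctan v + 2 * Real.pi := rfl
  rw [e]
  convert h using 1
  unfold dPhi
  ring

lemma Psi_nonneg (u : ℝ) : 0 ≤ Psi u := by
  rw [Psi_eq, sub_nonneg, Real.exp_le_one_iff]
  nlinarith [sq_nonneg (max u 0)]

lemma Psi_le_one (u : ℝ) : Psi u ≤ 1 := by
  rw [Psi_eq]
  linarith [Real.exp_pos (-(max u 0) ^ 2)]

lemma Psi_of_nonpos {u : ℝ} (h : u ≤ 0) : Psi u = 0 := by simp [Psi, h]

lemma dPsi_of_nonpos {u : ℝ} (h : u ≤ 0) : dPsi u = 0 := by simp [dPsi, h]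

lemma Psi_zero : Psi 0 = 0 := Psi_of_nonpos le_rfl

lemma dPsi_zero : dPsi 0 = 0 := dPsi_of_nonpos le_rfl

lemma Psi_add_Psi_neg_le_one (u : ℝ) : Psi u + Psi (-u) ≤ 1 := by
  rcases le_total u 0 with h | h
  · rw [Psi_of_nonpos h]; linarith [Psi_le_one (-u)]
  · rw [Psi_of_nonpos (neg_nonpos.mpr h)]; linarith [Psi_le_one u]

lemma Psi_ge_of_one_le {u : ℝ} (h : 1 ≤ u) : 3 / 5 ≤ Psi u := by
  have h1 : Real.exp (-u ^ 2) ≤ Real.exp (-1) := Real.exp_le_exp.mpr (by nlinarith)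
  -- The constant `3/5` lies below `1 - 1/e ≈ 0.632`.
  have h2 := Real.exp_neg_one_lt_d9
  unfold Psi
  rw [if_neg (by linarith)]
  linarith

lemma Psi_add_Psi_neg_ge {u : ℝ} (h : 1 ≤ |u|) : 3 / 5 ≤ Psi u + Psi (-u) := by
  rcases le_abs.mp h with h | h
  · linarith [Psi_ge_of_one_le h, Psi_nonneg (-u)]
  · linarith [Psi_ge_of_one_le h, Psi_nonneg u]

lemma dPsi_nonneg (u : ℝ) : 0 ≤ dPsi u := by
  unfold dPsi; positivity

lemma dPsi_le_one (u : ℝ) : dPsi u ≤ 1 := by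
  unfold dPsi
  rw [Real.exp_neg, ← div_eq_mul_inv, div_le_one (Real.exp_pos _)]
  -- With `p = max u 0`: `2p ≤ 1 + p² ≤ exp (p²)`.
  nlinarith [Real.add_one_le_exp ((max u 0) ^ 2), sq_nonneg (max u 0 - 1)]

lemma Phi_nonneg (v : ℝ) : 0 ≤ Phi v := by
  unfold Phi; linarith [Real.neg_pi_div_two_lt_arctan v]

lemma Phi_le (v : ℝ) : Phi v ≤ 4 * Real.pi := by
  unfold Phi; linarith [Real.arctan_lt_pi_div_two v]

lemma Phi_neg (v : ℝ) : Phi (-v) = 4 * Real.pi - Phi v := by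
  unfold Phi; rw [Real.arctan_neg]; ring

lemma dPhi_neg (v : ℝ) : dPhi (-v) = dPhi v := by simp [dPhi]

lemma dPhi_nonneg (v : ℝ) : 0 ≤ dPhi v := by unfold dPhi; positivity

lemma dPhi_le (v : ℝ) : dPhi v ≤ 4 := by
  unfold dPhi
  rw [div_le_iff₀ (by positivity)]
  nlinarith [sq_nonneg v]

lemma abs_sub_le_of_hasDerivAt {f f' : ℝ → ℝ} {C : ℝ} (hf : ∀ x, HasDerivAt f (f' x) x)
    (hC : ∀ x, |f' x| ≤ C) (a b : ℝ) : |f a - f b| ≤ C * |a - b| := by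
  have h := Convex.norm_image_sub_le_of_norm_hasDerivWithin_le (f := f) (f' := f') (s := Set.univ)
    (fun x _ => (hf x).hasDerivWithinAt) (fun x _ => hC x) convex_univ (Set.mem_univ b)
    (Set.mem_univ a)
  simpa [Real.norm_eq_abs] using h

lemma Psi_lipschitz (a b : ℝ) : |Psi a - Psi b| ≤ 1 * |a - b| :=
  abs_sub_le_of_hasDerivAt hasDerivAt_Psi
    (fun x => by rw [abs_of_nonneg (dPsi_nonneg x)]; exact dPsi_le_one x) a b

lemma Phi_lipschitz (a b : ℝ) : |Phi a - Phi b| ≤ 4 * |a - b| :=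
  abs_sub_le_of_hasDerivAt hasDerivAt_Phi
    (fun x => by rw [abs_of_nonneg (dPhi_nonneg x)]; exact dPhi_le x) a b

lemma dPhi_lipschitz (a b : ℝ) : |dPhi a - dPhi b| ≤ 4 * |a - b| := by
  have e : dPhi a - dPhi b = 4 * ((b - a) * ((a + b) / ((1 + a ^ 2) * (1 + b ^ 2)))) := by
    unfold dPhi
    have : 1 + a ^ 2 ≠ 0 := by positivity
    have : 1 + b ^ 2 ≠ 0 := by positivity
    field_simp
    ring
  have h : |(a + b) / ((1 + a ^ 2) * (1 + b ^ 2))| ≤ 1 := by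
    rw [abs_div, abs_of_pos (by positivity : 0 < (1 + a ^ 2) * (1 + b ^ 2)),
      div_le_one (by positivity), abs_le]
    constructor <;>
      nlinarith [sq_nonneg (a - 1), sq_nonneg (b - 1), sq_nonneg (a + 1), sq_nonneg (b + 1),
        mul_nonneg (sq_nonneg a) (sq_nonneg b)]
  rw [e, abs_mul, abs_mul, abs_of_pos (by norm_num : (0 : ℝ) < 4), abs_sub_comm b a]
  nlinarith [mul_le_mul_of_nonneg_left h (abs_nonneg (a - b))]

/-- `dPsi` need not be differentiable at `0`, so the bound is taken for the smooth function `2p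
exp(-p²)` and then composed with the `1`-Lipschitz map `max · 0`. -/
lemma dPsi_lipschitz (a b : ℝ) : |dPsi a - dPsi b| ≤ 2 * |a - b| := by
  have hd : ∀ x : ℝ, HasDerivAt (fun p : ℝ => 2 * p * Real.exp (-p ^ 2))
      ((2 - 4 * x ^ 2) * Real.exp (-x ^ 2)) x := by
    intro x
    have h1 : HasDerivAt (fun p : ℝ => 2 * p) 2 x := by
      simpa using (hasDerivAt_id x).const_mul 2
    have h2 : HasDerivAt (fun p : ℝ => Real.exp (-p ^ 2)) (Real.exp (-x ^ 2) * -(2 * x)) x := by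
      simpa using ((hasDerivAt_pow 2 x).fun_neg).exp
    refine (h1.fun_mul h2).congr_deriv ?_
    ring
  have hb : ∀ x : ℝ, |(2 - 4 * x ^ 2) * Real.exp (-x ^ 2)| ≤ 2 := by
    intro x
    rw [abs_mul, abs_of_pos (Real.exp_pos _), Real.exp_neg, ← div_eq_mul_inv,
      div_le_iff₀ (Real.exp_pos _), abs_le]
    have h := Real.quadratic_le_exp_of_nonneg (sq_nonneg x)
    constructor <;> nlinarith [sq_nonneg x, sq_nonneg (x ^ 2 - 1)]
  have h := abs_sub_le_of_hasDerivAt hd hb (max a 0) (max b 0)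
  have h2 : |max a 0 - max b 0| ≤ |a - b| := abs_max_sub_max_le_abs a b 0
  unfold dPsi
  linarith

/-! ## One link of the chain -/

/-- The function of two consecutive coordinates from which the `h_i` are built. -/
def link (u v : ℝ) : ℝ := Psi (-u) * Phi (-v) - Psi u * Phi v

/-- The partial derivative of `link` in the first variable. -/
def linkFst (u v : ℝ) : ℝ := -(dPsi (-u) * Phi (-v)) - dPsi u * Phi v

/-- The partial derivative of `link` in the second variable. -/
def linkSnd (u v : ℝ) : ℝ := -((Psi u + Psi (-u)) * dPhi v)

lemma neg_four_pi_le_link (u v : ℝ) : -(4 * Real.pi) ≤ link u v := by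
  have h1 := mul_nonneg (Psi_nonneg (-u)) (Phi_nonneg (-v))
  have h2 := mul_le_mul (Psi_le_one u) (Phi_le v) (Phi_nonneg v) zero_le_one
  unfold link; linarith

/-- This and `linkSnd_zero_left` make the function a chain: a zero coordinate hides its successor
from the gradient. -/
lemma linkFst_zero_left (v : ℝ) : linkFst 0 v = 0 := by simp [linkFst, dPsi_zero]

lemma linkSnd_zero_left (v : ℝ) : linkSnd 0 v = 0 := by simp [linkSnd, Psi_zero]

lemma linkFst_nonpos (u v : ℝ) : linkFst u v ≤ 0 := by
  have h1 := mul_nonneg (dPsi_nonneg (-u)) (Phi_nonneg (-v))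
  have h2 := mul_nonneg (dPsi_nonneg u) (Phi_nonneg v)
  unfold linkFst; linarith

/-- The two terms share a single `4π` because `Phi (-v) + Phi v = 4π`. -/
lemma abs_linkFst_le (u v : ℝ) : |linkFst u v| ≤ 4 * Real.pi := by
  rw [abs_of_nonpos (linkFst_nonpos u v)]
  have h1 := mul_le_mul_of_nonneg_right (dPsi_le_one (-u)) (Phi_nonneg (-v))
  have h2 := mul_le_mul_of_nonneg_right (dPsi_le_one u) (Phi_nonneg v)
  have h3 := Phi_neg v
  unfold linkFst; linarith

lemma abs_linkSnd_le (u v : ℝ) : |linkSnd u v| ≤ 4 := by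
  have h0 : 0 ≤ Psi u + Psi (-u) := add_nonneg (Psi_nonneg _) (Psi_nonneg _)
  unfold linkSnd
  rw [abs_neg, abs_of_nonneg (mul_nonneg h0 (dPhi_nonneg v))]
  have := mul_le_mul (Psi_add_Psi_neg_le_one u) (dPhi_le v) (dPhi_nonneg v) zero_le_one
  linarith

/-- The product of `3/5 ≤ Psi u + Psi (-u)` and `2 ≤ dPhi v`. It forces the slope at a small
coordinate that follows a large one. -/
lemma linkSnd_le {u v : ℝ} (hu : 1 ≤ |u|) (hv : |v| < 1) : linkSnd u v ≤ -(6 / 5) := by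
  have h1 : 2 ≤ dPhi v := by
    unfold dPhi
    rw [le_div_iff₀ (by positivity)]
    nlinarith [(sq_lt_one_iff_abs_lt_one v).mpr hv]
  have h2 := mul_le_mul (Psi_add_Psi_neg_ge hu) h1 (by norm_num)
    (add_nonneg (Psi_nonneg u) (Psi_nonneg (-u)))
  unfold linkSnd; linarith

lemma abs_mul_sub_mul_le {a b a' b' A B : ℝ} (hb : |b| ≤ B) (ha : |a'| ≤ A) :
    |a * b - a' * b'| ≤ B * |a - a'| + A * |b - b'| := by
  have e : a * b - a' * b' = (a - a') * b + a' * (b - b') := by ring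
  rw [e]
  refine (abs_add_le _ _).trans ?_
  rw [abs_mul, abs_mul]
  nlinarith [mul_le_mul_of_nonneg_left hb (abs_nonneg (a - a')),
    mul_le_mul_of_nonneg_right ha (abs_nonneg (b - b'))]

lemma abs_neg_sub_neg' (a b : ℝ) : |-a - -b| = |a - b| := by
  rw [neg_sub_neg, abs_sub_comm]

lemma linkSnd_lipschitz (u v u' v' : ℝ) :
    |linkSnd u v - linkSnd u' v'| ≤ 8 * |u - u'| + 4 * |v - v'| := by
  have h1 : |(Psi u + Psi (-u)) - (Psi u' + Psi (-u'))| ≤ 2 * |u - u'| := by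
    have e : (Psi u + Psi (-u)) - (Psi u' + Psi (-u')) =
      (Psi u - Psi u') + (Psi (-u) - Psi (-u')) := by ring
    have h := Psi_lipschitz (-u) (-u')
    rw [abs_neg_sub_neg'] at h
    rw [e]
    refine (abs_add_le _ _).trans ?_
    linarith [Psi_lipschitz u u']
  have h2 := abs_mul_sub_mul_le (a := Psi u + Psi (-u)) (b := dPhi v) (a' := Psi u' + Psi (-u'))
    (b' := dPhi v') (A := 1) (B := 4)
    (by rw [abs_of_nonneg (dPhi_nonneg v)]; exact dPhi_le v)
    (by rw [abs_of_nonneg (add_nonneg (Psi_nonneg _) (Psi_nonneg _))]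
        exact Psi_add_Psi_neg_le_one u')
  have h3 := dPhi_lipschitz v v'
  unfold linkSnd
  rw [abs_neg_sub_neg']
  linarith

lemma linkFst_lipschitz (u v u' v' : ℝ) :
    |linkFst u v - linkFst u' v'| ≤ 16 * Real.pi * |u - u'| + 8 * |v - v'| := by
  have key : ∀ a b a' b' : ℝ, |dPsi a * Phi b - dPsi a' * Phi b'| ≤
      8 * Real.pi * |a - a'| + 4 * |b - b'| := by
    intro a b a' b'
    have h2 := abs_mul_sub_mul_le (a := dPsi a) (b := Phi b) (a' := dPsi a')
      (b' := Phi b') (A := 1) (B := 4 * Real.pi)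
      (by rw [abs_of_nonneg (Phi_nonneg b)]; exact Phi_le b)
      (by rw [abs_of_nonneg (dPsi_nonneg a')]; exact dPsi_le_one a')
    have h3 := mul_le_mul_of_nonneg_left (dPsi_lipschitz a a')
      (by positivity : 0 ≤ 4 * Real.pi)
    linarith [Phi_lipschitz b b']
  have h1 := key (-u) (-v) (-u') (-v')
  have h2 := key u v u' v'
  rw [abs_neg_sub_neg', abs_neg_sub_neg'] at h1
  have e : linkFst u v - linkFst u' v' = -((dPsi (-u) * Phi (-v) - dPsi (-u') * Phi (-v')) +
    (dPsi u * Phi v - dPsi u' * Phi v')) := by unfold linkFst; ring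
  rw [e, abs_neg]
  refine (abs_add_le _ _).trans ?_
  linarith

/-! ## The functions `h_i` as weighted chains -/

/-- The coordinates `1, z_1, …, z_D, 0, …`. -/
def extCoord {D : ℕ} (z : Fin D → ℝ) (j : ℕ) : ℝ := if j = 0 then 1 else coord z j

/-- The weight of the `j`-th link in `h_{i+1}`. -/
def weight (m₁ m₂ D i j : ℕ) : ℝ :=
  if j = 0 ∨ D < j then 0 else if j = 1 then 1
  else if Even j then (if i + 1 ≤ m₁ * m₂ then 3 else 0)
  else (if 2 * (m₁ * m₂) < i + 1 then 3 else 0)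

/-- A weighted sum of links. -/
def chain (w : ℕ → ℝ) {D : ℕ} (z : Fin D → ℝ) : ℝ :=
  ∑ k ∈ Finset.range D, w (k + 1) * link (extCoord z k) (extCoord z (k + 1))

/-- The partial derivative of `chain` in the coordinate with zero-based index `k`. -/
def chainDeriv (w : ℕ → ℝ) {D : ℕ} (z : Fin D → ℝ) (k : ℕ) : ℝ :=
  w (k + 1) * linkSnd (extCoord z k) (extCoord z (k + 1)) +
    w (k + 2) * linkFst (extCoord z (k + 1)) (extCoord z (k + 2))

lemma extCoord_succ {D : ℕ} (z : Fin D → ℝ) (k : Fin D) : extCoord z (k + 1) = z k := by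
  have h : (k : ℕ) + 1 ≤ D := k.2
  simp [extCoord, coord, h]

lemma extCoord_zero {D : ℕ} (z : Fin D → ℝ) : extCoord z 0 = 1 := by simp [extCoord]

lemma extCoord_of_lt {D : ℕ} (z : Fin D → ℝ) {k : ℕ} (h : D < k) : extCoord z k = 0 := by
  have h1 : k ≠ 0 := by omega
  have h2 : ¬ (1 ≤ k ∧ k ≤ D) := by omega
  simp [extCoord, coord, h1, h2]

lemma weight_nonneg (m₁ m₂ D i j : ℕ) : 0 ≤ weight m₁ m₂ D i j := by
  unfold weight; split_ifs <;> norm_num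

lemma weight_le (m₁ m₂ D i j : ℕ) : weight m₁ m₂ D i j ≤ 3 := by
  unfold weight; split_ifs <;> norm_num

lemma weight_of_lt {m₁ m₂ D i j : ℕ} (h : D < j) : weight m₁ m₂ D i j = 0 := by
  simp [weight, h]

/-- The virtual coordinate `1` makes the first term an ordinary link, since `Psi (-1) = 0`. -/
lemma phi_one {D : ℕ} (z : Fin D → ℝ) : phi z 1 = link (extCoord z 0) (extCoord z 1) := by
  have h : Psi (-1) = 0 := Psi_of_nonpos (by norm_num)
  simp [phi, link, extCoord, h]

lemma phi_succ {D : ℕ} (z : Fin D → ℝ) {j : ℕ} (hj : 1 ≤ j) :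
    phi z (j + 1) = link (extCoord z j) (extCoord z (j + 1)) := by
  have h1 : j ≠ 0 := by omega
  simp [phi, link, extCoord, h1]

lemma sum_range_two_mul_add_one (F : ℕ → ℝ) (p : ℕ) :
    ∑ k ∈ Finset.range (2 * p + 1), F (k + 1) =
      F 1 + ∑ j ∈ Finset.Icc 1 p, (F (2 * j) + F (2 * j + 1)) := by
  induction p with
  | zero => simp
  | succ p ih =>
    rw [show 2 * (p + 1) + 1 = 2 * p + 1 + 1 + 1 by ring, Finset.sum_range_succ,
      Finset.sum_range_succ, ih, Finset.sum_Icc_succ_top (by omega)]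
    rw [show 2 * (p + 1) = 2 * p + 1 + 1 by ring]
    ring

/-- Oddness of `D` lets the links `2, …, D` be grouped in pairs `2j, 2j + 1`, with no term referring
to a coordinate beyond `D`. -/
lemma hFun_eq_chain (m₁ m₂ : ℕ) {D : ℕ} (hD : Odd D) (i : Fin (3 * m₁ * m₂)) (z : Fin D → ℝ) :
    hFun m₁ m₂ i z = chain (weight m₁ m₂ D i) z := by
  obtain ⟨p, rfl⟩ := hD
  have hp : (2 * p + 1) / 2 = p := by omega
  have e : chain (weight m₁ m₂ (2 * p + 1) i) z = phi z 1 + ∑ j ∈ Finset.Icc 1 p,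
      (weight m₁ m₂ (2 * p + 1) i (2 * j) * phi z (2 * j) +
        weight m₁ m₂ (2 * p + 1) i (2 * j + 1) * phi z (2 * j + 1)) := by
    have h := sum_range_two_mul_add_one
      (fun k => weight m₁ m₂ (2 * p + 1) i k * link (extCoord z (k - 1)) (extCoord z k)) p
    simp only [Nat.add_sub_cancel] at h
    unfold chain
    rw [h]
    congr 1
    · rw [phi_one]; simp [weight]
    · refine Finset.sum_congr rfl fun j hj => ?_
      rw [Finset.mem_Icc] at hj
      rw [phi_succ z (by omega : 1 ≤ 2 * j)]
      obtain ⟨q, hq⟩ : ∃ q, 2 * j = q + 1 := ⟨2 * j - 1, by omega⟩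
      rw [hq, phi_succ z (by omega : 1 ≤ q)]
      simp
  have hw : ∀ j ∈ Finset.Icc 1 p,
      weight m₁ m₂ (2 * p + 1) i (2 * j) = (if (i : ℕ) + 1 ≤ m₁ * m₂ then 3 else 0) ∧
      weight m₁ m₂ (2 * p + 1) i (2 * j + 1) =
        (if 2 * (m₁ * m₂) < (i : ℕ) + 1 then 3 else 0) := by
    intro j hj
    rw [Finset.mem_Icc] at hj
    unfold weight
    constructor
    · rw [if_neg (by omega), if_neg (by omega), if_pos (even_two_mul j)]
    · rw [if_neg (by omega), if_neg (by omega), if_neg (by simp)]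
  rw [e, Finset.sum_congr rfl fun j hj => by rw [(hw j hj).1, (hw j hj).2]]
  unfold hFun
  rw [hp]
  split_ifs with h1 h2 h3 h4
  · omega
  · rw [Finset.mul_sum]; simp
  · omega
  · simp
  · rw [Finset.mul_sum]; simp
  · omega

lemma hFun_zero (m₁ m₂ : ℕ) {D : ℕ} (i : Fin (3 * m₁ * m₂)) :
    hFun m₁ m₂ i (0 : Fin D → ℝ) ≤ 0 := by
  have hc : ∀ j, coord (0 : Fin D → ℝ) j = 0 := by intro j; unfold coord; split_ifs <;> rfl
  have h0 : ∀ j, j ≠ 1 → phi (0 : Fin D → ℝ) j = 0 := by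
    intro j hj; simp [phi, hj, hc, Psi_zero]
  have h1 : phi (0 : Fin D → ℝ) 1 ≤ 0 := by
    have := mul_nonneg (Psi_nonneg 1) (Phi_nonneg 0)
    simp only [phi, if_true, hc]; linarith
  have h2 : ∑ j ∈ Finset.Icc 1 (D / 2), phi (0 : Fin D → ℝ) (2 * j) = 0 :=
    Finset.sum_eq_zero fun j _ => h0 _ (by omega)
  have h3 : ∑ j ∈ Finset.Icc 1 (D / 2), phi (0 : Fin D → ℝ) (2 * j + 1) = 0 :=
    Finset.sum_eq_zero fun j hj => h0 _ (by rw [Finset.mem_Icc] at hj; omega)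
  unfold hFun
  rw [h2, h3]
  split_ifs <;> simpa using h1

lemma neg_weight_le_chain {w : ℕ → ℝ} (hw : ∀ j, 0 ≤ w j) {D : ℕ} (z : Fin D → ℝ) :
    -(4 * Real.pi) * ∑ k ∈ Finset.range D, w (k + 1) ≤ chain w z := by
  unfold chain
  rw [Finset.mul_sum]
  refine Finset.sum_le_sum fun k _ => ?_
  nlinarith [mul_le_mul_of_nonneg_left (neg_four_pi_le_link (extCoord z k) (extCoord z (k + 1)))
    (hw (k + 1))]

lemma hasFDerivAt_link {E : Type*} [NormedAddCommGroup E] [NormedSpace ℝ E] {a b : E → ℝ}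
    {a' b' : E →L[ℝ] ℝ} {x : E} (ha : HasFDerivAt a a' x) (hb : HasFDerivAt b b' x) :
    HasFDerivAt (fun z => link (a z) (b z))
      (linkFst (a x) (b x) • a' + linkSnd (a x) (b x) • b') x := by
  have h1 : HasFDerivAt (fun z => Psi (a z)) (dPsi (a x) • a') x :=
    (hasDerivAt_Psi (a x)).comp_hasFDerivAt x ha
  have h2 : HasFDerivAt (fun z => Psi (-a z)) (dPsi (-a x) • -a') x :=
    HasDerivAt.comp_hasFDerivAt (f := fun z => -a z) x (hasDerivAt_Psi (-a x)) ha.fun_neg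
  have h3 : HasFDerivAt (fun z => Phi (b z)) (dPhi (b x) • b') x :=
    (hasDerivAt_Phi (b x)).comp_hasFDerivAt x hb
  have h4 : HasFDerivAt (fun z => Phi (-b z)) (dPhi (-b x) • -b') x :=
    HasDerivAt.comp_hasFDerivAt (f := fun z => -b z) x (hasDerivAt_Phi (-b x)) hb.fun_neg
  have h := (h2.fun_mul h4).fun_sub (h1.fun_mul h3)
  unfold link
  refine h.congr_fderiv ?_
  ext v
  simp only [linkFst, linkSnd, dPhi_neg, _root_.add_apply,
    _root_.smul_apply, _root_.sub_apply, _root_.neg_apply,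
    smul_eq_mul]
  ring

lemma hasFDerivAt_chain {w : ℕ → ℝ} {D : ℕ} (hw : w (D + 1) = 0) (z : Fin D → ℝ) :
    HasFDerivAt (chain w)
      (∑ k : Fin D, chainDeriv w z k • ContinuousLinearMap.proj (R := ℝ) (φ := fun _ : Fin D => ℝ) k)
      z := by
  set δ : ℕ → ((Fin D → ℝ) →L[ℝ] ℝ) := fun j =>
    if h : 1 ≤ j ∧ j ≤ D then ContinuousLinearMap.proj ⟨j - 1, by omega⟩ else 0 with hδ
  have hcoord : ∀ j, HasFDerivAt (fun z : Fin D → ℝ => extCoord z j) (δ j) z := by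
    intro j
    by_cases h : 1 ≤ j ∧ j ≤ D
    · have h0 : j ≠ 0 := by omega
      simp only [extCoord, coord, h0, if_false, hδ, dif_pos h]
      exact (ContinuousLinearMap.proj (R := ℝ) (φ := fun _ : Fin D => ℝ)
        ⟨j - 1, by omega⟩).hasFDerivAt
    · simp only [extCoord, coord, hδ, dif_neg h]
      exact hasFDerivAt_const _ _
  have h1 : HasFDerivAt (chain w) (∑ k ∈ Finset.range D, w (k + 1) •
      (linkFst (extCoord z k) (extCoord z (k + 1)) • δ k +
        linkSnd (extCoord z k) (extCoord z (k + 1)) • δ (k + 1))) z := by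
    unfold chain
    exact HasFDerivAt.fun_sum fun k _ =>
      (hasFDerivAt_link (hcoord k) (hcoord (k + 1))).const_mul (w (k + 1))
  refine h1.congr_fderiv (Eq.symm ?_)
  have hproj : ∀ k : Fin D, (ContinuousLinearMap.proj (R := ℝ) (φ := fun _ : Fin D => ℝ) k) =
      δ (k + 1) := by
    intro k
    have hk : 1 ≤ (k : ℕ) + 1 ∧ (k : ℕ) + 1 ≤ D := ⟨by omega, k.2⟩
    simp only [hδ, dif_pos hk]
    rfl
  simp only [hproj]
  rw [Fin.sum_univ_eq_sum_range (fun k => chainDeriv w z k • δ (k + 1)) D]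
  set G : ℕ → ((Fin D → ℝ) →L[ℝ] ℝ) := fun k =>
    (w (k + 1) * linkFst (extCoord z k) (extCoord z (k + 1))) • δ k with hG
  -- Reindexing attaches each first-variable derivative to its own coordinate. The boundary terms
  -- vanish: the virtual coordinate is constant, and link `D + 1` has weight zero.
  have hshift : ∑ k ∈ Finset.range D, G (k + 1) = ∑ k ∈ Finset.range D, G k := by
    have e := Finset.sum_range_succ' G D
    rw [Finset.sum_range_succ] at e
    have h0 : G 0 = 0 := by simp [hG, hδ]
    have hDD : G D = 0 := by simp [hG, hw]
    rw [h0, hDD, add_zero, add_zero] at e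
    exact e.symm
  simp only [smul_add, Finset.sum_add_distrib, smul_smul]
  have : ∑ k ∈ Finset.range D, (w (k + 1) * linkFst (extCoord z k) (extCoord z (k + 1))) • δ k =
      ∑ k ∈ Finset.range D, G k := rfl
  rw [this, ← hshift, ← Finset.sum_add_distrib]
  refine Finset.sum_congr rfl fun k _ => ?_
  simp only [hG, chainDeriv, add_smul]
  rw [add_comm]

/-- `3 · 4 + 3 · 4π ≤ 25π`. Times the factor `2ε / √m` this is the origin of the `50π` in the
condition on `β`. -/
lemma abs_chainDeriv_le {w : ℕ → ℝ} (hw0 : ∀ j, 0 ≤ w j) (hw : ∀ j, w j ≤ 3) {D : ℕ}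
    (z : Fin D → ℝ) (k : ℕ) : |chainDeriv w z k| ≤ 25 * Real.pi := by
  unfold chainDeriv
  refine (abs_add_le _ _).trans ?_
  rw [abs_mul, abs_mul, abs_of_nonneg (hw0 _), abs_of_nonneg (hw0 _)]
  have h1 := mul_le_mul (hw (k + 1)) (abs_linkSnd_le (extCoord z k) (extCoord z (k + 1)))
    (abs_nonneg _) (by norm_num)
  have h2 := mul_le_mul (hw (k + 2)) (abs_linkFst_le (extCoord z (k + 1)) (extCoord z (k + 2)))
    (abs_nonneg _) (by norm_num)
  linarith [Real.pi_gt_three]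

lemma chainDeriv_lipschitz {w : ℕ → ℝ} (hw0 : ∀ j, 0 ≤ w j) (hw : ∀ j, w j ≤ 3) {D : ℕ}
    (z z' : Fin D → ℝ) (k : ℕ) : |chainDeriv w z k - chainDeriv w z' k| ≤
      24 * |extCoord z k - extCoord z' k| +
      (48 * Real.pi + 12) * |extCoord z (k + 1) - extCoord z' (k + 1)| +
      24 * |extCoord z (k + 2) - extCoord z' (k + 2)| := by
  have e : chainDeriv w z k - chainDeriv w z' k =
      w (k + 1) * (linkSnd (extCoord z k) (extCoord z (k + 1)) -
        linkSnd (extCoord z' k) (extCoord z' (k + 1))) +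
      w (k + 2) * (linkFst (extCoord z (k + 1)) (extCoord z (k + 2)) -
        linkFst (extCoord z' (k + 1)) (extCoord z' (k + 2))) := by
    unfold chainDeriv; ring
  rw [e]
  refine (abs_add_le _ _).trans ?_
  rw [abs_mul, abs_mul, abs_of_nonneg (hw0 _), abs_of_nonneg (hw0 _)]
  have h1 := mul_le_mul (hw (k + 1)) (linkSnd_lipschitz (extCoord z k) (extCoord z (k + 1))
    (extCoord z' k) (extCoord z' (k + 1))) (abs_nonneg _) (by norm_num)
  have h2 := mul_le_mul (hw (k + 2)) (linkFst_lipschitz (extCoord z (k + 1)) (extCoord z (k + 2))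
    (extCoord z' (k + 1)) (extCoord z' (k + 2))) (abs_nonneg _) (by norm_num)
  linarith

/-- The derivative in coordinate `k` depends on three neighbours, so this is a Schur test for a
tridiagonal matrix with entries `24, 48π + 12, 24`, whose sum `48π + 60` is at most `75π`. Shifting
the index loses nothing, as `q` vanishes at `0` and `D + 1`. -/
lemma sum_sq_chainDeriv_sub_le {w : ℕ → ℝ} (hw0 : ∀ j, 0 ≤ w j) (hw : ∀ j, w j ≤ 3) {D : ℕ}
    (z z' : Fin D → ℝ) :
    ∑ k : Fin D, (chainDeriv w z k - chainDeriv w z' k) ^ 2 ≤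
      (75 * Real.pi) ^ 2 * ∑ k : Fin D, (z k - z' k) ^ 2 := by
  set q : ℕ → ℝ := fun j => |extCoord z j - extCoord z' j| with hq
  set a : ℝ := 48 * Real.pi + 12 with ha
  have ha0 : 0 ≤ a := by positivity
  have hq0 : q 0 = 0 := by simp [hq, extCoord_zero]
  have hqD : q (D + 1) = 0 := by simp [hq, extCoord_of_lt]
  have hqk : ∀ k : Fin D, (z k - z' k) ^ 2 = q (k + 1) ^ 2 := by
    intro k; simp [hq, extCoord_succ, sq_abs]
  simp only [hqk]
  rw [Fin.sum_univ_eq_sum_range (fun k => q (k + 1) ^ 2) D,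
    Fin.sum_univ_eq_sum_range (fun k => (chainDeriv w z k - chainDeriv w z' k) ^ 2) D]
  have hS0 : 0 ≤ ∑ k ∈ Finset.range D, q (k + 1) ^ 2 := Finset.sum_nonneg fun _ _ => sq_nonneg _
  have hs1 : ∑ k ∈ Finset.range D, q k ^ 2 ≤ ∑ k ∈ Finset.range D, q (k + 1) ^ 2 := by
    have e := Finset.sum_range_succ' (fun k => q k ^ 2) D
    rw [Finset.sum_range_succ, hq0] at e
    nlinarith [sq_nonneg (q D)]
  have hs2 : ∑ k ∈ Finset.range D, q (k + 2) ^ 2 ≤ ∑ k ∈ Finset.range D, q (k + 1) ^ 2 := by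
    have e := Finset.sum_range_succ' (fun k => q (k + 1) ^ 2) D
    rw [Finset.sum_range_succ, hqD] at e
    nlinarith [sq_nonneg (q 1)]
  have hk : ∀ k ∈ Finset.range D, (chainDeriv w z k - chainDeriv w z' k) ^ 2 ≤
      (a + 48) * (24 * q k ^ 2 + a * q (k + 1) ^ 2 + 24 * q (k + 2) ^ 2) := by
    intro k _
    have h := chainDeriv_lipschitz hw0 hw z z' k
    have h1 : (chainDeriv w z k - chainDeriv w z' k) ^ 2 ≤
        (24 * q k + a * q (k + 1) + 24 * q (k + 2)) ^ 2 := by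
      rw [← sq_abs]
      exact pow_le_pow_left₀ (abs_nonneg _) h 2
    refine h1.trans ?_
    -- Weighted Cauchy–Schwarz with weights `24, a, 24` of total `a + 48`; the hints are its
    -- cross-difference squares.
    nlinarith [mul_nonneg ha0 (sq_nonneg (q k - q (k + 1))),
      mul_nonneg ha0 (sq_nonneg (q (k + 1) - q (k + 2))), sq_nonneg (q k - q (k + 2))]
  refine (Finset.sum_le_sum hk).trans ?_
  rw [← Finset.mul_sum, Finset.sum_add_distrib, Finset.sum_add_distrib, ← Finset.mul_sum,
    ← Finset.mul_sum, ← Finset.mul_sum]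
  have hπ : a + 48 ≤ 75 * Real.pi := by linarith [Real.pi_gt_three]
  calc _ ≤ (a + 48) * ((a + 48) * ∑ k ∈ Finset.range D, q (k + 1) ^ 2) := by
        refine mul_le_mul_of_nonneg_left ?_ (by linarith)
        linarith
    _ = (a + 48) ^ 2 * ∑ k ∈ Finset.range D, q (k + 1) ^ 2 := by ring
    _ ≤ _ := mul_le_mul_of_nonneg_right (pow_le_pow_left₀ (by linarith) hπ 2) hS0

/-! ## The gradient of the smooth part of the hard instance -/

/-- The scaling factor of the variables of `h_i`. -/
def scale (ε Lf : ℝ) (m₁ m₂ : ℕ) : ℝ := √((3 * m₁ * m₂ : ℕ) : ℝ) * Lf / (150 * Real.pi * ε)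

/-- The argument at which `h_i` is evaluated. -/
def scaledBlock (ε Lf : ℝ) (m₁ m₂ : ℕ) {D : ℕ}
    (x : EuclideanSpace ℝ (Fin (3 * m₁ * m₂) × Fin D)) (i : Fin (3 * m₁ * m₂)) : Fin D → ℝ :=
  fun j => scale ε Lf m₁ m₂ * x (i, j)

/-- The gradient of the smooth part of the hard instance. -/
def hardGrad (ε Lf : ℝ) (m₁ m₂ : ℕ) {D : ℕ}
    (x : EuclideanSpace ℝ (Fin (3 * m₁ * m₂) × Fin D)) :
    EuclideanSpace ℝ (Fin (3 * m₁ * m₂) × Fin D) :=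
  WithLp.toLp 2 fun p => 2 * ε / √((3 * m₁ * m₂ : ℕ) : ℝ) *
    chainDeriv (weight m₁ m₂ D p.1) (scaledBlock ε Lf m₁ m₂ x p.1) p.2

lemma hardInstance_f₀_eq {ε Lf : ℝ} (β : ℝ) {m₁ m₂ D : ℕ} (hD : Odd D)
    (x : EuclideanSpace ℝ (Fin (3 * m₁ * m₂) × Fin D)) :
    (hardInstance ε Lf β m₁ m₂ D).f₀ x =
      ∑ i : Fin (3 * m₁ * m₂), 300 * Real.pi * ε ^ 2 / (((3 * m₁ * m₂ : ℕ) : ℝ) * Lf) *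
        chain (weight m₁ m₂ D i) (scaledBlock ε Lf m₁ m₂ x i) := by
  change ∑ i, fFun ε Lf m₁ m₂ i (fun j => x (i, j)) = _
  refine Finset.sum_congr rfl fun i _ => ?_
  unfold fFun
  rw [hFun_eq_chain _ _ hD]
  congr 2
  funext j
  unfold scaledBlock scale
  ring

lemma factor_mul_scale {ε Lf : ℝ} (hε : 0 < ε) (hLf : 0 < Lf) {m₁ m₂ : ℕ}
    (hm : 0 < 3 * m₁ * m₂) :
    300 * Real.pi * ε ^ 2 / (((3 * m₁ * m₂ : ℕ) : ℝ) * Lf) * scale ε Lf m₁ m₂ =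
      2 * ε / √((3 * m₁ * m₂ : ℕ) : ℝ) := by
  have hm' : (0 : ℝ) < ((3 * m₁ * m₂ : ℕ) : ℝ) := by exact_mod_cast hm
  unfold scale
  generalize ((3 * m₁ * m₂ : ℕ) : ℝ) = m at *
  have h1 : 0 < √m := Real.sqrt_pos.mpr hm'
  have h2 : √m ^ 2 = m := Real.sq_sqrt hm'.le
  have hπ := Real.pi_pos
  rw [← h2]
  field_simp
  rw [Real.sqrt_sq h1.le]
  ring

/-- The scaling of the instance is chosen so that the constant `75π` of the chain becomes exactly
`Lf`. -/
lemma factor_mul_scale_mul {ε Lf : ℝ} (hε : 0 < ε) {m₁ m₂ : ℕ} (hm : 0 < 3 * m₁ * m₂) :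
    2 * ε / √((3 * m₁ * m₂ : ℕ) : ℝ) * (75 * Real.pi) * scale ε Lf m₁ m₂ = Lf := by
  have hm' : (0 : ℝ) < ((3 * m₁ * m₂ : ℕ) : ℝ) := by exact_mod_cast hm
  unfold scale
  generalize ((3 * m₁ * m₂ : ℕ) : ℝ) = m at *
  have h1 : 0 < √m := Real.sqrt_pos.mpr hm'
  have hπ := Real.pi_pos
  field_simp
  ring

lemma hasGradientAt_hardInstance {ε Lf : ℝ} (hε : 0 < ε) (hLf : 0 < Lf) (β : ℝ) {m₁ m₂ D : ℕ}
    (hm : 0 < 3 * m₁ * m₂) (hD : Odd D) (x : EuclideanSpace ℝ (Fin (3 * m₁ * m₂) × Fin D)) :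
    HasGradientAt (hardInstance ε Lf β m₁ m₂ D).f₀ (hardGrad ε Lf m₁ m₂ x) x := by
  rw [hasGradientAt_iff_hasFDerivAt]
  have e : (hardInstance ε Lf β m₁ m₂ D).f₀ = _ := funext fun x => hardInstance_f₀_eq β hD x
  rw [e]
  set pr : Fin (3 * m₁ * m₂) → Fin D → (EuclideanSpace ℝ (Fin (3 * m₁ * m₂) × Fin D) →L[ℝ] ℝ) :=
    fun i k => EuclideanSpace.proj (i, k)
  have hpv : ∀ i k v, pr i k v = v (i, k) := fun _ _ _ => rfl
  have hb : ∀ i : Fin (3 * m₁ * m₂), HasFDerivAt (fun x => scaledBlock ε Lf m₁ m₂ x i)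
      (ContinuousLinearMap.pi fun k : Fin D => scale ε Lf m₁ m₂ • pr i k) x := by
    intro i
    rw [hasFDerivAt_pi]
    intro k
    exact ((pr i k).hasFDerivAt).const_mul _
  have hc : ∀ i : Fin (3 * m₁ * m₂),
      HasFDerivAt (fun x => chain (weight m₁ m₂ D i) (scaledBlock ε Lf m₁ m₂ x i)) _ x :=
    fun i => HasFDerivAt.comp (g := chain (weight m₁ m₂ D i))
      (f := fun x => scaledBlock ε Lf m₁ m₂ x i) x
      (hasFDerivAt_chain (weight_of_lt (Nat.lt_succ_self D)) (scaledBlock ε Lf m₁ m₂ x i)) (hb i)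
  have h : HasFDerivAt (fun x => ∑ i : Fin (3 * m₁ * m₂),
      300 * Real.pi * ε ^ 2 / (((3 * m₁ * m₂ : ℕ) : ℝ) * Lf) *
        chain (weight m₁ m₂ D i) (scaledBlock ε Lf m₁ m₂ x i)) _ x :=
    HasFDerivAt.fun_sum fun i _ => (hc i).const_mul _
  refine h.congr_fderiv (Eq.symm ?_)
  ext v
  rw [InnerProductSpace.toDual_apply_apply]
  simp only [PiLp.inner_apply, hardGrad, _root_.sum_apply,
    _root_.smul_apply, ContinuousLinearMap.comp_apply, ContinuousLinearMap.proj_apply,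
    ContinuousLinearMap.pi_apply, smul_eq_mul, Fintype.sum_prod_type, Finset.mul_sum,
    RCLike.inner_apply, conj_trivial, hpv]
  refine Finset.sum_congr rfl fun i _ => Finset.sum_congr rfl fun k _ => ?_
  rw [← factor_mul_scale hε hLf hm]
  ring

lemma gradient_hardInstance {ε Lf : ℝ} (hε : 0 < ε) (hLf : 0 < Lf) (β : ℝ) {m₁ m₂ D : ℕ}
    (hm : 0 < 3 * m₁ * m₂) (hD : Odd D) (x : EuclideanSpace ℝ (Fin (3 * m₁ * m₂) × Fin D)) :
    gradient (hardInstance ε Lf β m₁ m₂ D).f₀ x = hardGrad ε Lf m₁ m₂ x :=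
  (hasGradientAt_hardInstance hε hLf β hm hD x).gradient

lemma isSmoothWith_hardInstance {ε Lf : ℝ} (hε : 0 < ε) (hLf : 0 < Lf) (β : ℝ) {m₁ m₂ D : ℕ}
    (hm : 0 < 3 * m₁ * m₂) (hD : Odd D) :
    IsSmoothWith Lf (hardInstance ε Lf β m₁ m₂ D).f₀ := by
  refine ⟨fun x => (hasGradientAt_hardInstance hε hLf β hm hD x).differentiableAt,
    fun x x' => ?_⟩
  rw [gradient_hardInstance hε hLf β hm hD, gradient_hardInstance hε hLf β hm hD]
  refine le_of_sq_le_sq ?_ (by positivity)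
  rw [mul_pow, EuclideanSpace.real_norm_sq_eq, EuclideanSpace.real_norm_sq_eq,
    Fintype.sum_prod_type, Fintype.sum_prod_type, Finset.mul_sum]
  refine Finset.sum_le_sum fun i _ => ?_
  have h := sum_sq_chainDeriv_sub_le (weight_nonneg m₁ m₂ D i) (weight_le m₁ m₂ D i)
    (scaledBlock ε Lf m₁ m₂ x i) (scaledBlock ε Lf m₁ m₂ x' i)
  have hL := factor_mul_scale_mul (Lf := Lf) hε hm
  set c := 2 * ε / √((3 * m₁ * m₂ : ℕ) : ℝ) with hc
  set s := scale ε Lf m₁ m₂ with hs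
  have e1 : ∑ k : Fin D, (hardGrad ε Lf m₁ m₂ x - hardGrad ε Lf m₁ m₂ x') (i, k) ^ 2 =
      c ^ 2 * ∑ k : Fin D, (chainDeriv (weight m₁ m₂ D i) (scaledBlock ε Lf m₁ m₂ x i) k -
        chainDeriv (weight m₁ m₂ D i) (scaledBlock ε Lf m₁ m₂ x' i) k) ^ 2 := by
    rw [Finset.mul_sum]
    refine Finset.sum_congr rfl fun k _ => ?_
    simp only [hardGrad, PiLp.sub_apply]
    ring
  have e2 : ∑ k : Fin D, (scaledBlock ε Lf m₁ m₂ x i k - scaledBlock ε Lf m₁ m₂ x' i k) ^ 2 =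
      s ^ 2 * ∑ k : Fin D, ((x - x') (i, k)) ^ 2 := by
    rw [Finset.mul_sum]
    refine Finset.sum_congr rfl fun k _ => ?_
    simp only [scaledBlock, PiLp.sub_apply]
    ring
  rw [e2] at h
  calc _ ≤ _ := e1.le.trans (mul_le_mul_of_nonneg_left h (sq_nonneg c))
    _ = (c * (75 * Real.pi) * s) ^ 2 * ∑ k : Fin D, ((x - x') (i, k)) ^ 2 := by ring
    _ = _ := by rw [hL]

/-! ## Matrices acting on Euclidean spaces -/

section General

variable {ι κ κb : Type} [Fintype ι]

lemma mv_apply [Fintype κ] [DecidableEq ι] (B : Matrix κ ι ℝ) (x : EuclideanSpace ℝ ι) (r : κ) :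
    mv B x r = ∑ i, B r i * x i := rfl

lemma inner_mv_transpose [Fintype κ] [DecidableEq ι] [DecidableEq κ] (B : Matrix κ ι ℝ)
    (y : EuclideanSpace ℝ κ) (x : EuclideanSpace ℝ ι) :
    inner ℝ (mv Bᵀ y) x = inner ℝ y (mv B x) := by
  simp only [PiLp.inner_apply, mv_apply, RCLike.inner_apply, conj_trivial, Matrix.transpose_apply,
    Finset.mul_sum, Finset.sum_mul]
  rw [Finset.sum_comm]
  exact Finset.sum_congr rfl fun r _ => Finset.sum_congr rfl fun i _ => by ring

/-! ## Consequences of stationarity -/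

/-- The first-order condition along a direction in the kernel of the constraint matrix. -/
lemma Problem.IsStationary.inner_le [Fintype κ] [Fintype κb] [DecidableEq ι] [DecidableEq κ]
    {P : Problem ι κ κb} {ε : ℝ} {x : EuclideanSpace ℝ ι}
    (h : P.IsStationary ε x) (hε : 0 ≤ ε) {d : EuclideanSpace ℝ ι} {a : ℝ} (hd : mv P.A d = 0)
    (ha : ∀ v ∈ subdiff P.g x, inner ℝ v d ≤ a) :
    -(ε * ‖d‖) ≤ inner ℝ (gradient P.f₀ x) d + a := by
  obtain ⟨γ, hγ, -⟩ := h
  refine le_of_forall_pos_le_add fun δ hδ => ?_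
  have hd0 : 0 < ‖d‖ + 1 := by positivity
  -- The distance need not be attained, hence the slack. Dividing by `‖d‖ + 1` keeps its product
  -- with `‖d‖` at most `δ`, also when `d = 0`.
  have hδ' : 0 < δ / (‖d‖ + 1) := by positivity
  have hlt : Metric.infEDist 0 ((fun v => gradient P.f₀ x + mv P.Aᵀ γ + v) '' subdiff P.g x)
      < ENNReal.ofReal (ε + δ / (‖d‖ + 1)) :=
    hγ.trans_lt ((ENNReal.ofReal_lt_ofReal_iff (by positivity)).mpr (by linarith))
  obtain ⟨_, ⟨v, hv, rfl⟩, hw⟩ := Metric.infEDist_lt_iff.mp hlt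
  rw [edist_dist, ENNReal.ofReal_lt_ofReal_iff (by positivity), dist_zero_left] at hw
  have h1 := (abs_le.mp (abs_real_inner_le_norm (gradient P.f₀ x + mv P.Aᵀ γ + v) d)).1
  rw [inner_add_left, inner_add_left, inner_mv_transpose, hd, inner_zero_right] at h1
  have h2 := mul_le_mul_of_nonneg_right hw.le (norm_nonneg d)
  have h3 : δ / (‖d‖ + 1) * ‖d‖ ≤ δ := by
    rw [div_mul_eq_mul_div, div_le_iff₀ hd0]
    nlinarith
  linarith [ha v hv]

/-- The subgradient inequality at the single point `x + d` suffices, so a stationarity estimate only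
needs the change of the regularizer along `d`. -/
lemma inner_le_of_mem_subdiff {G : EuclideanSpace ℝ ι → ℝ} {h : EuclideanSpace ℝ ι → EReal}
    (hG : ∀ x, h x = (G x : EReal)) {x v d : EuclideanSpace ℝ ι} {a : ℝ} (hv : v ∈ subdiff h x)
    (ha : G (x + d) ≤ G x + a) : inner ℝ v d ≤ a := by
  have h1 := hv (x + d)
  rw [hG, hG, add_sub_cancel_left, ← EReal.coe_add, EReal.coe_le_coe_iff] at h1
  linarith

end General

/-! ## The matrices of the hard instance -/

/-- The block on the left of a row of `J`. -/
def leftBlock {m : ℕ} (r : Fin (m - 1)) : Fin m := ⟨r, by omega⟩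

/-- The block on the right of a row of `J`. -/
def rightBlock {m : ℕ} (r : Fin (m - 1)) : Fin m := ⟨r + 1, by omega⟩

lemma sum_J_mul {m : ℕ} (r : Fin (m - 1)) (f : Fin m → ℝ) :
    ∑ i, J m r i * f i = f (rightBlock r) - f (leftBlock r) := by
  have h : ∀ i, J m r i * f i =
      (if i = rightBlock r then f i else 0) - (if i = leftBlock r then f i else 0) := by
    intro i
    have h1 : i = leftBlock r ↔ (i : ℕ) = r := by simp [Fin.ext_iff, leftBlock]
    have h2 : i = rightBlock r ↔ (i : ℕ) = r + 1 := by simp [Fin.ext_iff, rightBlock]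
    simp only [J, h1, h2]
    split_ifs <;> first | omega | ring
  simp [h, Finset.sum_sub_distrib]

/-- The rows of `c J ⊗ I` selected by `p`. -/
def blockRows (c : ℝ) (m D : ℕ) (p : Fin (m - 1) → Prop) :
    Matrix ({r // p r} × Fin D) (Fin m × Fin D) ℝ :=
  c • (((J m).submatrix Subtype.val id) ⊗ₖ (1 : Matrix (Fin D) (Fin D) ℝ))

lemma blockRows_apply (c : ℝ) (m D : ℕ) (p : Fin (m - 1) → Prop) (r : {r // p r} × Fin D)
    (i : Fin m × Fin D) :
    blockRows c m D p r i = c * (J m r.1 i.1 * if r.2 = i.2 then 1 else 0) := by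
  simp [blockRows, Matrix.one_apply]

lemma mv_blockRows {c : ℝ} {m D : ℕ} {p : Fin (m - 1) → Prop} [DecidablePred p]
    (x : EuclideanSpace ℝ (Fin m × Fin D)) (r : {r // p r}) (k : Fin D) :
    mv (blockRows c m D p) x (r, k) = c * (x (rightBlock r.1, k) - x (leftBlock r.1, k)) := by
  rw [mv_apply, ← sum_J_mul r.1 (fun i => x (i, k)), Fintype.sum_prod_type, Finset.mul_sum]
  refine Finset.sum_congr rfl fun i _ => ?_
  simp only [blockRows_apply]
  simp [mul_assoc]

lemma mv_blockRows_transpose {c : ℝ} {m D : ℕ} {p : Fin (m - 1) → Prop} [DecidablePred p]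
    (y : EuclideanSpace ℝ ({r // p r} × Fin D)) (i : Fin m) (k : Fin D) :
    mv (blockRows c m D p)ᵀ y (i, k) = c * ∑ r : {r // p r}, J m r.1 i * y (r, k) := by
  rw [mv_apply, Fintype.sum_prod_type, Finset.mul_sum]
  refine Finset.sum_congr rfl fun i _ => ?_
  simp only [blockRows_apply, Matrix.transpose_apply]
  simp [mul_assoc]

lemma hardA_eq (Lf : ℝ) (m₁ m₂ D : ℕ) : hardA Lf m₁ m₂ D =
    blockRows (((3 * m₁ * m₂ : ℕ) : ℝ) * Lf) (3 * m₁ * m₂) D (fun r => ¬ m₁ ∣ (r : ℕ) + 1) := rfl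

lemma hardAbar_eq (Lf : ℝ) (m₁ m₂ D : ℕ) : hardAbar Lf m₁ m₂ D =
    blockRows (((3 * m₁ * m₂ : ℕ) : ℝ) * Lf) (3 * m₁ * m₂) D (fun r => m₁ ∣ (r : ℕ) + 1) := rfl

lemma mv_hardA {Lf : ℝ} {m₁ m₂ D : ℕ} (x : EuclideanSpace ℝ (Fin (3 * m₁ * m₂) × Fin D))
    (r : RowMc m₁ m₂) (k : Fin D) : mv (hardA Lf m₁ m₂ D) x (r, k) =
      (((3 * m₁ * m₂ : ℕ) : ℝ) * Lf) * (x (rightBlock r.1, k) - x (leftBlock r.1, k)) :=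
  mv_blockRows x r k

lemma mv_hardAbar {Lf : ℝ} {m₁ m₂ D : ℕ} (x : EuclideanSpace ℝ (Fin (3 * m₁ * m₂) × Fin D))
    (r : RowM m₁ m₂) (k : Fin D) : mv (hardAbar Lf m₁ m₂ D) x (r, k) =
      (((3 * m₁ * m₂ : ℕ) : ℝ) * Lf) * (x (rightBlock r.1, k) - x (leftBlock r.1, k)) :=
  mv_blockRows x r k

/-- The regularizer of the hard instance as a real function. -/
def hardReg (β : ℝ) (m₁ m₂ D : ℕ) (x : EuclideanSpace ℝ (Fin (3 * m₁ * m₂) × Fin D)) : ℝ :=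
  β * ∑ r : RowM m₁ m₂ × Fin D, |x (rightBlock r.1.1, r.2) - x (leftBlock r.1.1, r.2)|

lemma hardInstance_g {ε Lf β : ℝ} (hLf : 0 < Lf) {m₁ m₂ D : ℕ} (hm : 0 < 3 * m₁ * m₂)
    (x : EuclideanSpace ℝ (Fin (3 * m₁ * m₂) × Fin D)) :
    (hardInstance ε Lf β m₁ m₂ D).g x = ((hardReg β m₁ m₂ D x : ℝ) : EReal) := by
  have hc : 0 < ((3 * m₁ * m₂ : ℕ) : ℝ) * Lf := mul_pos (by exact_mod_cast hm) hLf
  have h : (hardInstance ε Lf β m₁ m₂ D).g x = ((β / (((3 * m₁ * m₂ : ℕ) : ℝ) * Lf) *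
      ∑ k, |mv (hardAbar Lf m₁ m₂ D) x k + 0| : ℝ) : EReal) := rfl
  rw [h, hardReg]
  congr 1
  have h2 : ∀ k : RowM m₁ m₂ × Fin D, |mv (hardAbar Lf m₁ m₂ D) x k + 0| =
      (((3 * m₁ * m₂ : ℕ) : ℝ) * Lf) *
        |x (rightBlock k.1.1, k.2) - x (leftBlock k.1.1, k.2)| := by
    rintro ⟨r, k⟩
    rw [mv_hardAbar, add_zero, abs_mul, abs_of_pos hc]
  simp only [h2]
  rw [← Finset.mul_sum]
  field_simp

/-! ### Stationary points of the hard instance -/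

lemma abs_hardGrad_le {ε Lf : ℝ} (hε : 0 < ε) {m₁ m₂ D : ℕ}
    (x : EuclideanSpace ℝ (Fin (3 * m₁ * m₂) × Fin D)) (p : Fin (3 * m₁ * m₂) × Fin D) :
    |hardGrad ε Lf m₁ m₂ x p| ≤ 50 * Real.pi * ε / √((3 * m₁ * m₂ : ℕ) : ℝ) := by
  have hc : 0 ≤ 2 * ε / √((3 * m₁ * m₂ : ℕ) : ℝ) := by positivity
  have h := abs_chainDeriv_le (weight_nonneg m₁ m₂ D p.1) (weight_le m₁ m₂ D p.1)
    (scaledBlock ε Lf m₁ m₂ x p.1) p.2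
  change |2 * ε / √((3 * m₁ * m₂ : ℕ) : ℝ) * _| ≤ _
  rw [abs_mul, abs_of_nonneg hc]
  refine (mul_le_mul_of_nonneg_left h hc).trans (le_of_eq ?_)
  ring

/-- A vector whose blocks are multiples of the `k`-th unit vector. -/
def spread {m D : ℕ} (k : Fin D) (f : Fin m → ℝ) : EuclideanSpace ℝ (Fin m × Fin D) :=
  WithLp.toLp 2 fun p => if p.2 = k then f p.1 else 0

lemma spread_apply {m D : ℕ} (k : Fin D) (f : Fin m → ℝ) (i : Fin m) (j : Fin D) :
    spread k f (i, j) = if j = k then f i else 0 := rfl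

lemma norm_sq_spread {m D : ℕ} (k : Fin D) (f : Fin m → ℝ) :
    ‖spread k f‖ ^ 2 = ∑ i, f i ^ 2 := by
  rw [EuclideanSpace.real_norm_sq_eq, Fintype.sum_prod_type]
  refine Finset.sum_congr rfl fun i _ => ?_
  simp [spread_apply]

lemma norm_spread_le {m D : ℕ} (k : Fin D) {f : Fin m → ℝ} {a : ℝ} (hf : ∀ i, |f i| ≤ a)
    (ha : 0 ≤ a) : ‖spread k f‖ ≤ √(m : ℝ) * a := by
  refine le_of_sq_le_sq ?_ (by positivity)
  rw [norm_sq_spread, mul_pow, Real.sq_sqrt (Nat.cast_nonneg m)]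
  refine (Finset.sum_le_sum fun i _ =>
    sq_le_sq' (abs_le.mp (hf i)).1 (abs_le.mp (hf i)).2).trans ?_
  simp

lemma inner_spread {m D : ℕ} (x : EuclideanSpace ℝ (Fin m × Fin D)) (k : Fin D) (f : Fin m → ℝ) :
    inner ℝ x (spread k f) = ∑ i, x (i, k) * f i := by
  simp only [PiLp.inner_apply, RCLike.inner_apply, conj_trivial, Fintype.sum_prod_type,
    spread_apply]
  refine Finset.sum_congr rfl fun i _ => ?_
  simp [mul_comm]

lemma mv_hardA_spread {Lf : ℝ} {m₁ m₂ D : ℕ} (k : Fin D) {f : Fin (3 * m₁ * m₂) → ℝ}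
    (hf : ∀ r : RowMc m₁ m₂, f (rightBlock r.1) = f (leftBlock r.1)) :
    mv (hardA Lf m₁ m₂ D) (spread k f) = 0 := by
  ext ⟨r, j⟩
  rw [mv_hardA, spread_apply, spread_apply, hf]
  simp

/-- At a stationary point the regularizer vanishes. -/
lemma eq_of_isStationary {ε Lf β : ℝ} (hε : 0 < ε) (hLf : 0 < Lf) {m₁ m₂ D : ℕ}
    (hm : 0 < 3 * m₁ * m₂) (hD : Odd D)
    (hβ : (50 * Real.pi + 1) * √((3 * m₁ * m₂ : ℕ) : ℝ) * ε < β)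
    {x : EuclideanSpace ℝ (Fin (3 * m₁ * m₂) × Fin D)}
    (hx : (hardInstance ε Lf β m₁ m₂ D).IsStationary ε x) (r : RowM m₁ m₂) (k : Fin D) :
    x (rightBlock r.1, k) = x (leftBlock r.1, k) := by
  by_contra hne
  set δ := x (rightBlock r.1, k) - x (leftBlock r.1, k) with hδ
  have hδ0 : 0 < |δ| := abs_pos.mpr (sub_ne_zero.mpr hne)
  -- Shifting all blocks up to `r` by `δ` closes the jump at `r` and changes no other difference. As
  -- row `r` belongs to `Ā`, the direction lies in the kernel of `A`.
  set f : Fin (3 * m₁ * m₂) → ℝ := fun i => if (i : ℕ) ≤ r.1 then δ else 0 with hf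
  have hjump : ∀ r' : Fin (3 * m₁ * m₂ - 1), r' ≠ r.1 → f (rightBlock r') = f (leftBlock r') := by
    intro r' hr'
    have : (r' : ℕ) ≠ r.1 := fun h => hr' (Fin.ext h)
    simp only [hf, rightBlock, leftBlock]
    split_ifs <;> first | rfl | omega
  have hA : mv (hardInstance ε Lf β m₁ m₂ D).A (spread k f) = 0 := by
    refine mv_hardA_spread k fun r' => hjump r'.1 fun h => r'.2 ?_
    rw [h]; exact r.2
  have hR : hardReg β m₁ m₂ D (x + spread k f) ≤ hardReg β m₁ m₂ D x + -(β * |δ|) := by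
    have hsum : ∑ p : RowM m₁ m₂ × Fin D, |(x + spread k f) (rightBlock p.1.1, p.2) -
          (x + spread k f) (leftBlock p.1.1, p.2)| =
        ∑ p : RowM m₁ m₂ × Fin D, (|x (rightBlock p.1.1, p.2) - x (leftBlock p.1.1, p.2)| -
          if p = (r, k) then |δ| else 0) := by
      refine Finset.sum_congr rfl fun p _ => ?_
      obtain ⟨r', j⟩ := p
      simp only [PiLp.add_apply, spread_apply, Prod.mk.injEq]
      by_cases hj : j = k
      · by_cases hr : r' = r
        · subst hj hr
          simp [hf, rightBlock, leftBlock, hδ]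
        · have := hjump r'.1 fun h => hr (Subtype.ext h)
          simp [hj, hr, this]
      · simp [hj]
    have hsum2 : ∑ p : RowM m₁ m₂ × Fin D, (if p = (r, k) then |δ| else 0) = |δ| := by simp
    unfold hardReg
    rw [hsum, Finset.sum_sub_distrib, hsum2]
    linarith
  have hf_abs : ∀ i, |f i| ≤ |δ| := by
    intro i; simp only [hf]; split_ifs <;> simp
  have h1 := hx.inner_le hε.le hA (a := -(β * |δ|)) fun v hv =>
    inner_le_of_mem_subdiff (fun x => hardInstance_g hLf hm x) hv hR
  rw [gradient_hardInstance hε hLf β hm hD, inner_spread] at h1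
  have h2 := norm_spread_le k hf_abs (abs_nonneg δ)
  have hm' : (0 : ℝ) < ((3 * m₁ * m₂ : ℕ) : ℝ) := by exact_mod_cast hm
  have hs := Real.sqrt_pos.mpr hm'
  have h3 : ∑ i, hardGrad ε Lf m₁ m₂ x (i, k) * f i ≤
      50 * Real.pi * ε * √((3 * m₁ * m₂ : ℕ) : ℝ) * |δ| := by
    calc _ ≤ ∑ i : Fin (3 * m₁ * m₂), 50 * Real.pi * ε / √((3 * m₁ * m₂ : ℕ) : ℝ) * |δ| := by
          refine Finset.sum_le_sum fun i _ => (le_abs_self _).trans ?_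
          rw [abs_mul]
          exact mul_le_mul (abs_hardGrad_le hε x (i, k)) (hf_abs i) (abs_nonneg _) (by positivity)
      _ = _ := by
          rw [Finset.sum_const, Finset.card_univ, Fintype.card_fin, nsmul_eq_mul]
          generalize ((3 * m₁ * m₂ : ℕ) : ℝ) = m at *
          have : m = √m * √m := (Real.mul_self_sqrt hm'.le).symm
          rw [div_mul_eq_mul_div, ← mul_div_assoc, div_eq_iff hs.ne']
          linear_combination (50 * Real.pi * ε * |δ|) * this
  -- The regularizer drops by `β |δ|`, but stationarity permits at most `50πε√m |δ|` from the
  -- gradient plus `ε√m |δ|` from the tolerance.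
  have h4 := mul_le_mul_of_nonneg_left h2 hε.le
  have h5 := mul_lt_mul_of_pos_right hβ hδ0
  linarith

/-- Telescoping and Cauchy–Schwarz. It serves both the agreement of blocks and the lower eigenvalue
bound. -/
lemma sq_sub_le_mul_sum_sq (a : ℕ → ℝ) {i j n : ℕ} (hij : i ≤ j) (hj : j ≤ n) :
    (a j - a i) ^ 2 ≤ n * ∑ r ∈ Finset.range n, (a (r + 1) - a r) ^ 2 := by
  rw [← Finset.sum_Ico_sub a hij]
  refine (sq_sum_le_card_mul_sum_sq).trans ?_
  have hsub : Finset.Ico i j ⊆ Finset.range n := fun r hr => by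
    rw [Finset.mem_Ico] at hr; rw [Finset.mem_range]; omega
  have h2 : ∑ r ∈ Finset.Ico i j, (a (r + 1) - a r) ^ 2 ≤
      ∑ r ∈ Finset.range n, (a (r + 1) - a r) ^ 2 :=
    Finset.sum_le_sum_of_subset_of_nonneg hsub fun _ _ _ => sq_nonneg _
  have h1 : (((Finset.Ico i j).card : ℕ) : ℝ) ≤ n := by
    rw [Nat.card_Ico]; exact_mod_cast (by omega : j - i ≤ n)
  exact mul_le_mul h1 h2 (Finset.sum_nonneg fun _ _ => sq_nonneg _) (Nat.cast_nonneg _)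

lemma sum_subtype_add_sum_compl {n : ℕ} (p : Fin n → Prop) [DecidablePred p] (F : Fin n → ℝ) :
    ∑ r : {r // p r}, F r.1 + ∑ r : {r // ¬ p r}, F r.1 = ∑ r, F r :=
  Fintype.sum_subtype_add_sum_subtype p F

/-- At a stationary point all blocks nearly agree. -/
lemma abs_sub_le_of_isStationary {ε Lf β : ℝ} (hε : 0 < ε) (hLf : 0 < Lf) {m₁ m₂ D : ℕ}
    (hm : 0 < 3 * m₁ * m₂) (hD : Odd D)
    (hβ : (50 * Real.pi + 1) * √((3 * m₁ * m₂ : ℕ) : ℝ) * ε < β)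
    {x : EuclideanSpace ℝ (Fin (3 * m₁ * m₂) × Fin D)}
    (hx : (hardInstance ε Lf β m₁ m₂ D).IsStationary ε x) (i i' : Fin (3 * m₁ * m₂)) (k : Fin D) :
    |scaledBlock ε Lf m₁ m₂ x i k - scaledBlock ε Lf m₁ m₂ x i' k| ≤ 1 / (150 * Real.pi) := by
  have hm' : (0 : ℝ) < ((3 * m₁ * m₂ : ℕ) : ℝ) := by exact_mod_cast hm
  set c : ℝ := ((3 * m₁ * m₂ : ℕ) : ℝ) * Lf with hc
  have hc0 : 0 < c := mul_pos hm' hLf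
  have heq := eq_of_isStationary hε hLf hm hD hβ hx
  obtain ⟨-, -, hA⟩ := hx
  have hA' : ‖mv (hardA Lf m₁ m₂ D) x‖ ≤ ε := by
    have : (hardInstance ε Lf β m₁ m₂ D).b = 0 := rfl
    rwa [this, add_zero] at hA
  have hA2 : ‖mv (hardA Lf m₁ m₂ D) x‖ ^ 2 ≤ ε ^ 2 := pow_le_pow_left₀ (norm_nonneg _) hA' 2
  rw [EuclideanSpace.real_norm_sq_eq, Fintype.sum_prod_type_right] at hA2
  have hk : ∑ r : RowMc m₁ m₂, (mv (hardA Lf m₁ m₂ D) x (r, k)) ^ 2 ≤ ε ^ 2 :=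
    (Finset.single_le_sum (f := fun k : Fin D =>
      ∑ r : RowMc m₁ m₂, (mv (hardA Lf m₁ m₂ D) x (r, k)) ^ 2)
      (fun _ _ => Finset.sum_nonneg fun _ _ => sq_nonneg _) (Finset.mem_univ k)).trans hA2
  simp only [mv_hardA, mul_pow] at hk
  rw [← Finset.mul_sum] at hk
  -- The jumps at rows of `Ā` are zero by `heq`, so the constraint bound on `A x` controls all
  -- jumps.
  have hall : c ^ 2 * ∑ r : Fin (3 * m₁ * m₂ - 1),
      (x (rightBlock r, k) - x (leftBlock r, k)) ^ 2 ≤ ε ^ 2 := by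
    rw [← sum_subtype_add_sum_compl (fun r : Fin (3 * m₁ * m₂ - 1) => m₁ ∣ (r : ℕ) + 1)]
    rw [Finset.sum_eq_zero (f := fun r : {r : Fin (3 * m₁ * m₂ - 1) // m₁ ∣ (r : ℕ) + 1} =>
      (x (rightBlock r.1, k) - x (leftBlock r.1, k)) ^ 2) fun r _ => by rw [heq r k]; simp,
      zero_add, hc, mul_pow]
    exact hk
  set a : ℕ → ℝ := fun n => if h : n < 3 * m₁ * m₂ then x (⟨n, h⟩, k) else 0 with ha
  have hai : ∀ i : Fin (3 * m₁ * m₂), a i = x (i, k) := fun i => by simp [ha]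
  have hsum : ∑ r ∈ Finset.range (3 * m₁ * m₂ - 1), (a (r + 1) - a r) ^ 2 =
      ∑ r : Fin (3 * m₁ * m₂ - 1), (x (rightBlock r, k) - x (leftBlock r, k)) ^ 2 := by
    rw [← Fin.sum_univ_eq_sum_range (fun r => (a (r + 1) - a r) ^ 2)]
    refine Finset.sum_congr rfl fun r _ => ?_
    rw [← hai, ← hai]
    rfl
  have hdiff : ∀ i i' : Fin (3 * m₁ * m₂), (x (i, k) - x (i', k)) ^ 2 ≤
      ((3 * m₁ * m₂ : ℕ) : ℝ) * (ε ^ 2 / c ^ 2) := by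
    intro i i'
    wlog hle : i' ≤ i generalizing i i'
    · rw [← neg_sub, neg_sq]; exact this i' i (le_of_lt (not_le.mp hle))
    have h1 := sq_sub_le_mul_sum_sq a (i := i') (j := i) (n := 3 * m₁ * m₂ - 1) hle (by omega)
    rw [hai, hai, hsum] at h1
    refine h1.trans (mul_le_mul ?_ ?_ (Finset.sum_nonneg fun _ _ => sq_nonneg _) hm'.le)
    · exact_mod_cast Nat.sub_le _ _
    · rw [le_div_iff₀ (by positivity), mul_comm]; exact hall
  refine abs_le_of_sq_le_sq ?_ (by positivity)
  have h1 := hdiff i i'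
  have e : (scaledBlock ε Lf m₁ m₂ x i k - scaledBlock ε Lf m₁ m₂ x i' k) ^ 2 =
      scale ε Lf m₁ m₂ ^ 2 * (x (i, k) - x (i', k)) ^ 2 := by unfold scaledBlock; ring
  rw [e]
  refine (mul_le_mul_of_nonneg_left h1 (sq_nonneg _)).trans (le_of_eq ?_)
  unfold scale
  rw [hc]
  generalize ((3 * m₁ * m₂ : ℕ) : ℝ) = m at *
  rw [div_pow, mul_pow, Real.sq_sqrt hm'.le]
  have := Real.pi_pos
  field_simp

/-- The factor `3` compensates for a link being present in only one third of the blocks. -/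
lemma sum_weight {m₁ m₂ D k : ℕ} (hk : k < D) :
    ∑ i : Fin (3 * m₁ * m₂), weight m₁ m₂ D i (k + 1) = ((3 * m₁ * m₂ : ℕ) : ℝ) := by
  have h0 : ¬ (k + 1 = 0 ∨ D < k + 1) := by omega
  rw [Fin.sum_univ_eq_sum_range (fun i => weight m₁ m₂ D i (k + 1))]
  simp only [weight, if_neg h0]
  rw [mul_assoc]
  generalize m₁ * m₂ = M
  split_ifs with h1 h2
  · simp
  · rw [← Finset.sum_filter, Finset.sum_const,
      show (Finset.range (3 * M)).filter (fun i => i + 1 ≤ M) = Finset.range M by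
        ext i; simp only [Finset.mem_filter, Finset.mem_range]; omega]
    simp [mul_comm]
  · rw [← Finset.sum_filter, Finset.sum_const,
      show (Finset.range (3 * M)).filter (fun i => 2 * M < i + 1) = Finset.Ico (2 * M) (3 * M) by
        ext i; simp only [Finset.mem_filter, Finset.mem_range, Finset.mem_Ico]; omega,
      Nat.card_Ico, show 3 * M - 2 * M = M by omega]
    simp [mul_comm]

/-- All coordinates of a stationary point are large. -/
lemma one_le_abs_of_isStationary {ε Lf β : ℝ} (hε : 0 < ε) (hLf : 0 < Lf) {m₁ m₂ D : ℕ}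
    (hm : 0 < 3 * m₁ * m₂) (hD : Odd D)
    (hβ : (50 * Real.pi + 1) * √((3 * m₁ * m₂ : ℕ) : ℝ) * ε < β)
    {x : EuclideanSpace ℝ (Fin (3 * m₁ * m₂) × Fin D)}
    (hx : (hardInstance ε Lf β m₁ m₂ D).IsStationary ε x) (i₀ : Fin (3 * m₁ * m₂)) (k : Fin D) :
    1 ≤ |scaledBlock ε Lf m₁ m₂ x i₀ k| := by
  obtain ⟨k, hkD⟩ := k
  induction k using Nat.strong_induction_on with
  | _ k ih =>
  by_contra! hlt
  have hm' : (0 : ℝ) < ((3 * m₁ * m₂ : ℕ) : ℝ) := by exact_mod_cast hm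
  have hs := Real.sqrt_pos.mpr hm'
  have hπ := Real.pi_gt_three
  set z := scaledBlock ε Lf m₁ m₂ x with hz
  -- The virtual coordinate `1` starts the induction.
  have hprev : 1 ≤ |extCoord (z i₀) k| := by
    cases k with
    | zero => simp [extCoord]
    | succ k =>
      have h := ih k (Nat.lt_succ_self k) (by omega)
      rwa [← extCoord_succ (z i₀) ⟨k, by omega⟩] at h
  have hcur : |extCoord (z i₀) (k + 1)| < 1 := by
    rwa [← extCoord_succ (z i₀) ⟨k, hkD⟩] at hlt
  have hlink := linkSnd_le hprev hcur
  have hdist : ∀ i j, |extCoord (z i) j - extCoord (z i₀) j| ≤ 1 / (150 * Real.pi) := by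
    intro i j
    unfold extCoord coord
    split_ifs
    · simp; positivity
    · exact abs_sub_le_of_isStationary hε hLf hm hD hβ hx i i₀ _
    · simp; positivity
  -- The slope is estimated at the reference block `i₀`, dropping the nonpositive `linkFst` term.
  -- The error `1/2` is the Lipschitz constant `75π` times the block deviation `1 / (150π)`.
  have hterm : ∀ i : Fin (3 * m₁ * m₂), chainDeriv (weight m₁ m₂ D i) (z i) k ≤
      weight m₁ m₂ D i (k + 1) * -(6 / 5) + 1 / 2 := by
    intro i
    have h1 := chainDeriv_lipschitz (weight_nonneg m₁ m₂ D i) (weight_le m₁ m₂ D i) (z i) (z i₀) k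
    have h2 : 24 * |extCoord (z i) k - extCoord (z i₀) k| +
        (48 * Real.pi + 12) * |extCoord (z i) (k + 1) - extCoord (z i₀) (k + 1)| +
        24 * |extCoord (z i) (k + 2) - extCoord (z i₀) (k + 2)| ≤ 1 / 2 := by
      have e : (1 : ℝ) / 2 = 75 * Real.pi * (1 / (150 * Real.pi)) := by field_simp; norm_num
      have h3 := mul_le_mul_of_nonneg_left (hdist i (k + 1))
        (by positivity : 0 ≤ 48 * Real.pi + 12)
      have h4 : 0 < 1 / (150 * Real.pi) := by positivity
      rw [e]
      nlinarith [hdist i k, hdist i (k + 2)]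
    have h3 : chainDeriv (weight m₁ m₂ D i) (z i₀) k ≤ weight m₁ m₂ D i (k + 1) * -(6 / 5) := by
      unfold chainDeriv
      have h4 := mul_le_mul_of_nonneg_left hlink (weight_nonneg m₁ m₂ D i (k + 1))
      have h5 := mul_nonpos_of_nonneg_of_nonpos (weight_nonneg m₁ m₂ D i (k + 2))
        (linkFst_nonpos (extCoord (z i₀) (k + 1)) (extCoord (z i₀) (k + 2)))
      linarith
    linarith [(abs_le.mp (h1.trans h2)).2]
  have hsum : ∑ i : Fin (3 * m₁ * m₂), chainDeriv (weight m₁ m₂ D i) (z i) k ≤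
      -(7 / 10) * ((3 * m₁ * m₂ : ℕ) : ℝ) := by
    refine (Finset.sum_le_sum fun i _ => hterm i).trans ?_
    rw [Finset.sum_add_distrib, ← Finset.sum_mul, sum_weight hkD, Finset.sum_const,
      Finset.card_univ, Fintype.card_fin, nsmul_eq_mul]
    linarith
  -- Equal shifts of all blocks leave every difference unchanged, so both the multiplier and the
  -- regularizer drop out.
  have h1 := hx.inner_le hε.le (d := spread ⟨k, hkD⟩ fun _ => 1) (a := 0)
    (mv_hardA_spread _ fun _ => rfl) fun v hv =>
      inner_le_of_mem_subdiff (fun x => hardInstance_g hLf hm x) hv (by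
        simp [hardReg, spread_apply])
  have h2 := norm_spread_le (m := 3 * m₁ * m₂) (⟨k, hkD⟩ : Fin D) (f := fun _ => (1 : ℝ)) (a := 1)
    (fun _ => by simp) zero_le_one
  rw [gradient_hardInstance hε hLf β hm hD, inner_spread] at h1
  have e : ∑ i, hardGrad ε Lf m₁ m₂ x (i, ⟨k, hkD⟩) * 1 = 2 * ε / √((3 * m₁ * m₂ : ℕ) : ℝ) *
      ∑ i : Fin (3 * m₁ * m₂), chainDeriv (weight m₁ m₂ D i) (z i) k := by
    rw [Finset.mul_sum]
    exact Finset.sum_congr rfl fun i _ => mul_one _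
  rw [e] at h1
  have h3 := mul_le_mul_of_nonneg_left hsum
    (by positivity : 0 ≤ 2 * ε / √((3 * m₁ * m₂ : ℕ) : ℝ))
  have h4 := mul_le_mul_of_nonneg_left h2 hε.le
  generalize ((3 * m₁ * m₂ : ℕ) : ℝ) = m at *
  -- The averaged slope `-6/5 + 1/2 = -7/10` gives `-(7/5) ε√m`, beyond the allowed `-ε√m`.
  have e2 : 2 * ε / √m * (-(7 / 10) * m) = -(7 / 5) * (ε * √m) := by
    have hmm : m = √m * √m := (Real.mul_self_sqrt hm'.le).symm
    rw [div_mul_eq_mul_div, div_eq_iff hs.ne']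
    linear_combination (-(7 / 5) * ε) * hmm
  have h5 : 0 < ε * √m := mul_pos hε hs
  linarith

/-! ## The condition number of the hard instance -/

/-- The transpose of `J` is a difference operator with zero boundary values at both ends. -/
lemma sum_J_transpose_mul {m : ℕ} (i : Fin m) {F : ℕ → ℝ} (h0 : F 0 = 0) (hm : F m = 0) :
    ∑ r : Fin (m - 1), J m r i * F (r + 1) = F i - F (i + 1) := by
  have h : ∀ r : Fin (m - 1), J m r i * F (r + 1) =
      (if (i : ℕ) = r + 1 then F (r + 1) else 0) - (if (i : ℕ) = r then F (r + 1) else 0) := by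
    intro r
    simp only [J]
    split_ifs <;> first | omega | ring
  rw [Finset.sum_congr rfl fun r _ => h r,
    Fin.sum_univ_eq_sum_range (fun r : ℕ => (if (i : ℕ) = r + 1 then F (r + 1) else 0) -
        (if (i : ℕ) = r then F (r + 1) else 0)), Finset.sum_sub_distrib]
  congr 1
  · rcases Nat.eq_zero_or_pos (i : ℕ) with hi | hi
    · rw [hi, h0]
      exact Finset.sum_eq_zero fun r _ => if_neg (by omega)
    · rw [Finset.sum_eq_single ((i : ℕ) - 1), if_pos (by omega), Nat.sub_add_cancel hi]
      · exact fun r _ hr => if_neg (by omega)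
      · intro hr
        have := i.2
        rw [Finset.mem_range] at hr
        omega
  · rw [Finset.sum_ite_eq]
    split_ifs with hi
    · rfl
    · rw [Finset.mem_range] at hi
      have := i.2
      rw [show (i : ℕ) + 1 = m by omega, hm]

/-- A discrete Poincaré inequality: each value is a sum of increments starting from zero. -/
lemma sum_sq_le_mul_sum_sq_sub {m : ℕ} {F : ℕ → ℝ} (h0 : F 0 = 0) :
    ∑ r ∈ Finset.range (m - 1), F (r + 1) ^ 2 ≤
      (m : ℝ) ^ 2 * ∑ i ∈ Finset.range m, (F i - F (i + 1)) ^ 2 := by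
  have hS : 0 ≤ ∑ i ∈ Finset.range m, (F i - F (i + 1)) ^ 2 :=
    Finset.sum_nonneg fun _ _ => sq_nonneg _
  have h : ∀ r ∈ Finset.range (m - 1), F (r + 1) ^ 2 ≤
      m * ∑ i ∈ Finset.range m, (F i - F (i + 1)) ^ 2 := by
    intro r hr
    rw [Finset.mem_range] at hr
    have h1 := sq_sub_le_mul_sum_sq F (Nat.zero_le (r + 1)) (by omega : r + 1 ≤ m)
    rw [h0, sub_zero] at h1
    refine h1.trans (le_of_eq ?_)
    congr 1
    exact Finset.sum_congr rfl fun i _ => by ring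
  refine (Finset.sum_le_sum h).trans ?_
  rw [Finset.sum_const, Finset.card_range, nsmul_eq_mul, pow_two, mul_assoc]
  refine mul_le_mul_of_nonneg_right ?_ (mul_nonneg (Nat.cast_nonneg m) hS)
  exact_mod_cast Nat.sub_le m 1

lemma sum_sq_sub_le {m : ℕ} (hm0 : 0 < m) {F : ℕ → ℝ} (h0 : F 0 = 0) (hm : F m = 0) :
    ∑ i ∈ Finset.range m, (F i - F (i + 1)) ^ 2 ≤
      4 * ∑ r ∈ Finset.range (m - 1), F (r + 1) ^ 2 := by
  obtain ⟨n, rfl⟩ : ∃ n, m = n + 1 := ⟨m - 1, by omega⟩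
  rw [Nat.add_sub_cancel]
  have h1 : ∑ i ∈ Finset.range (n + 1), F i ^ 2 = ∑ r ∈ Finset.range n, F (r + 1) ^ 2 := by
    rw [Finset.sum_range_succ', h0]; simp
  have h2 : ∑ i ∈ Finset.range (n + 1), F (i + 1) ^ 2 = ∑ r ∈ Finset.range n, F (r + 1) ^ 2 := by
    rw [Finset.sum_range_succ, hm]; simp
  have h3 : ∑ i ∈ Finset.range (n + 1), (F i - F (i + 1)) ^ 2 ≤
      ∑ i ∈ Finset.range (n + 1), (2 * F i ^ 2 + 2 * F (i + 1) ^ 2) :=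
    Finset.sum_le_sum fun i _ => by nlinarith [sq_nonneg (F i + F (i + 1))]
  rw [Finset.sum_add_distrib, ← Finset.mul_sum, ← Finset.mul_sum, h1, h2] at h3
  linarith

/-- The entries of a vector indexed by the rows of `[Ā; A]`, in the order of the rows of `J`. -/
def rowValue {m D : ℕ} {p : Fin (m - 1) → Prop} [DecidablePred p]
    (v : ({r // p r} × Fin D) ⊕ ({r // ¬ p r} × Fin D) → ℝ) (k : Fin D) (n : ℕ) : ℝ :=
  if h : 1 ≤ n ∧ n ≤ m - 1 then
    if hp : p ⟨n - 1, by omega⟩ then v (Sum.inl (⟨_, hp⟩, k)) else v (Sum.inr (⟨_, hp⟩, k))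
  else 0

section RowValue

variable {m D : ℕ} {p : Fin (m - 1) → Prop} [DecidablePred p]
  (v : ({r // p r} × Fin D) ⊕ ({r // ¬ p r} × Fin D) → ℝ) (k : Fin D)

lemma rowValue_zero : rowValue v k 0 = 0 := by simp [rowValue]

lemma rowValue_last (hm : 0 < m) : rowValue v k m = 0 := by
  unfold rowValue; rw [dif_neg (by omega)]

lemma rowValue_inl (r : {r // p r}) : rowValue v k (r.1 + 1) = v (Sum.inl (r, k)) := by
  have h : 1 ≤ (r.1 : ℕ) + 1 ∧ (r.1 : ℕ) + 1 ≤ m - 1 := ⟨by omega, r.1.2⟩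
  unfold rowValue
  rw [dif_pos h, dif_pos (by exact r.2)]
  rfl

lemma rowValue_inr (r : {r // ¬ p r}) : rowValue v k (r.1 + 1) = v (Sum.inr (r, k)) := by
  have h : 1 ≤ (r.1 : ℕ) + 1 ∧ (r.1 : ℕ) + 1 ≤ m - 1 := ⟨by omega, r.1.2⟩
  unfold rowValue
  rw [dif_pos h, dif_neg (by exact r.2)]
  rfl

lemma sum_rowValue (G : Fin (m - 1) → ℝ → ℝ) :
    ∑ r : {r // p r}, G r.1 (v (Sum.inl (r, k))) + ∑ r : {r // ¬ p r}, G r.1 (v (Sum.inr (r, k))) =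
      ∑ r : Fin (m - 1), G r (rowValue v k (r + 1)) := by
  rw [← sum_subtype_add_sum_compl p]
  simp only [rowValue_inl, rowValue_inr]

lemma dotProduct_rowValue : v ⬝ᵥ v =
    ∑ k, ∑ r ∈ Finset.range (m - 1), rowValue v k (r + 1) ^ 2 := by
  rw [dotProduct, Fintype.sum_sum_type, Fintype.sum_prod_type_right, Fintype.sum_prod_type_right,
    ← Finset.sum_add_distrib]
  refine Finset.sum_congr rfl fun k _ => ?_
  rw [← Fin.sum_univ_eq_sum_range (fun r => rowValue v k (r + 1) ^ 2),
    ← sum_rowValue v k fun _ t => t ^ 2]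
  simp only [pow_two]

lemma fromRows_transpose_mulVec (hm : 0 < m) (c : ℝ) (i : Fin m) :
    ((Matrix.fromRows (blockRows c m D p) (blockRows c m D fun r => ¬ p r))ᵀ *ᵥ v) (i, k) =
      c * (rowValue v k i - rowValue v k (i + 1)) := by
  rw [← sum_J_transpose_mul i (rowValue_zero v k) (rowValue_last v k hm),
    ← sum_rowValue v k fun r t => J m r i * t, mul_add, Finset.mul_sum, Finset.mul_sum,
    Matrix.mulVec, dotProduct, Fintype.sum_sum_type, Fintype.sum_prod_type, Fintype.sum_prod_type]
  congr 1 <;>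
  · refine Finset.sum_congr rfl fun r _ => ?_
    simp only [Matrix.transpose_apply, Matrix.fromRows_apply_inl, Matrix.fromRows_apply_inr,
      blockRows_apply]
    simp [mul_assoc]

end RowValue

/-- For an eigenvector `v`, `‖Bᵀ v‖² = μ ‖v‖²`. After the rows of `[Ā; A]` are put back in the order
of `J`, `Bᵀ` is `c` times the difference operator in each coordinate, so the Poincaré bound and the
trivial bound `4` apply. -/
lemma eigenvalue_bounds {m D : ℕ} (hm : 0 < m) {c : ℝ} (p : Fin (m - 1) → Prop)
    [DecidablePred p] {μ : ℝ}
    (hμ : Module.End.HasEigenvalue (Matrix.toLin'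
      (Matrix.fromRows (blockRows c m D p) (blockRows c m D fun r => ¬ p r) *
        (Matrix.fromRows (blockRows c m D p) (blockRows c m D fun r => ¬ p r))ᵀ)) μ) :
    c ^ 2 ≤ (m : ℝ) ^ 2 * μ ∧ μ ≤ 4 * c ^ 2 := by
  obtain ⟨v, hv⟩ := hμ.exists_hasEigenvector
  have hv0 : 0 < v ⬝ᵥ v :=
    lt_of_le_of_ne (Finset.sum_nonneg fun i _ => mul_self_nonneg (v i))
      fun h => hv.2 (dotProduct_self_eq_zero.mp h.symm)
  set B := Matrix.fromRows (blockRows c m D p) (blockRows c m D fun r => ¬ p r) with hB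
  have h1 : (Bᵀ *ᵥ v) ⬝ᵥ (Bᵀ *ᵥ v) = μ * (v ⬝ᵥ v) := by
    have h2 := hv.apply_eq_smul
    rw [Matrix.toLin'_apply] at h2
    have h3 : v ⬝ᵥ ((B * Bᵀ) *ᵥ v) = μ * (v ⬝ᵥ v) := by rw [h2, dotProduct_smul, smul_eq_mul]
    rw [← h3, ← Matrix.mulVec_mulVec, Matrix.dotProduct_mulVec v B, ← Matrix.mulVec_transpose]
  have h2 : (Bᵀ *ᵥ v) ⬝ᵥ (Bᵀ *ᵥ v) =
      c ^ 2 * ∑ k, ∑ i ∈ Finset.range m, (rowValue v k i - rowValue v k (i + 1)) ^ 2 := by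
    rw [dotProduct, Fintype.sum_prod_type_right, Finset.mul_sum]
    refine Finset.sum_congr rfl fun k _ => ?_
    rw [Finset.mul_sum,
      ← Fin.sum_univ_eq_sum_range (fun i => c ^ 2 * (rowValue v k i - rowValue v k (i + 1)) ^ 2)]
    refine Finset.sum_congr rfl fun i _ => ?_
    rw [hB, fromRows_transpose_mulVec v k hm c i]
    ring
  have h3 := dotProduct_rowValue v
  have h4 : v ⬝ᵥ v ≤
      (m : ℝ) ^ 2 * ∑ k, ∑ i ∈ Finset.range m, (rowValue v k i - rowValue v k (i + 1)) ^ 2 := by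
    rw [h3, Finset.mul_sum]
    exact Finset.sum_le_sum fun k _ => sum_sq_le_mul_sum_sq_sub (rowValue_zero v k)
  have h5 : ∑ k, ∑ i ∈ Finset.range m, (rowValue v k i - rowValue v k (i + 1)) ^ 2 ≤
      4 * (v ⬝ᵥ v) := by
    rw [h3, Finset.mul_sum]
    exact Finset.sum_le_sum fun k _ =>
      sum_sq_sub_le hm (rowValue_zero v k) (rowValue_last v k hm)
  rw [h1] at h2
  have h6 := mul_le_mul_of_nonneg_left h4 (sq_nonneg c)
  have h7 := mul_le_mul_of_nonneg_left h5 (sq_nonneg c)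
  constructor
  · refine le_of_mul_le_mul_right ?_ hv0
    nlinarith
  · refine le_of_mul_le_mul_right ?_ hv0
    nlinarith

lemma condNumber_le {Lf : ℝ} (hLf : 0 < Lf) {m₁ m₂ D : ℕ} (hm : 0 < 3 * m₁ * m₂) :
    condNumber (Matrix.fromRows (hardAbar Lf m₁ m₂ D) (hardA Lf m₁ m₂ D)) ≤
      2 * ((3 * m₁ * m₂ : ℕ) : ℝ) := by
  have hm' : (0 : ℝ) < ((3 * m₁ * m₂ : ℕ) : ℝ) := by exact_mod_cast hm
  have hc0 : 0 < ((3 * m₁ * m₂ : ℕ) : ℝ) * Lf := mul_pos hm' hLf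
  have hb := fun μ => eigenvalue_bounds (D := D) (c := ((3 * m₁ * m₂ : ℕ) : ℝ) * Lf) hm
    (fun r => m₁ ∣ (r : ℕ) + 1) (μ := μ)
  rw [hardA_eq, hardAbar_eq]
  unfold condNumber
  generalize ((3 * m₁ * m₂ : ℕ) : ℝ) * Lf = c at *
  generalize ((3 * m₁ * m₂ : ℕ) : ℝ) = m at *
  rw [Real.sqrt_le_left (by positivity)]
  have hsup := Real.sSup_le (fun μ hμ => (hb μ hμ).2) (by positivity)
  -- Without positive eigenvalues the infimum is `0` by convention and so is the quotient.
  rcases Set.eq_empty_or_nonempty {μ : ℝ | 0 < μ ∧ Module.End.HasEigenvalue (Matrix.toLin'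
      (Matrix.fromRows (blockRows c (3 * m₁ * m₂) D fun r => m₁ ∣ (r : ℕ) + 1)
        (blockRows c (3 * m₁ * m₂) D fun r => ¬ m₁ ∣ (r : ℕ) + 1) *
      (Matrix.fromRows (blockRows c (3 * m₁ * m₂) D fun r => m₁ ∣ (r : ℕ) + 1)
        (blockRows c (3 * m₁ * m₂) D fun r => ¬ m₁ ∣ (r : ℕ) + 1))ᵀ)) μ} with he | hne
  · rw [he, Real.sInf_empty, div_zero]; positivity
  · have hinf := le_csInf hne (a := c ^ 2 / m ^ 2) fun μ hμ => by
      rw [div_le_iff₀ (by positivity), mul_comm μ]; exact (hb μ hμ.2).1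
    rw [div_le_iff₀ (lt_of_lt_of_le (by positivity) hinf)]
    rw [div_le_iff₀ (by positivity)] at hinf
    exact hsup.trans (by nlinarith)

/-! ## Values of the objective -/

lemma hardInstance_F₀ {ε Lf β : ℝ} (hLf : 0 < Lf) {m₁ m₂ D : ℕ} (hm : 0 < 3 * m₁ * m₂)
    (x : EuclideanSpace ℝ (Fin (3 * m₁ * m₂) × Fin D)) :
    (hardInstance ε Lf β m₁ m₂ D).F₀ x =
      (((hardInstance ε Lf β m₁ m₂ D).f₀ x + hardReg β m₁ m₂ D x : ℝ) : EReal) := by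
  rw [Problem.F₀, hardInstance_g hLf hm, EReal.coe_add]

lemma hardReg_nonneg {β : ℝ} (hβ : 0 ≤ β) {m₁ m₂ D : ℕ}
    (x : EuclideanSpace ℝ (Fin (3 * m₁ * m₂) × Fin D)) : 0 ≤ hardReg β m₁ m₂ D x :=
  mul_nonneg hβ (Finset.sum_nonneg fun _ _ => abs_nonneg _)

/-- Each of the `D` links has total weight `m` over the blocks and is at least `-4π`. -/
lemma le_hardInstance_f₀ {ε Lf : ℝ} (hLf : 0 < Lf) (β : ℝ) {m₁ m₂ D : ℕ}
    (hm : 0 < 3 * m₁ * m₂) (hD : Odd D) (x : EuclideanSpace ℝ (Fin (3 * m₁ * m₂) × Fin D)) :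
    -(1200 * Real.pi ^ 2 * ε ^ 2 * D / Lf) ≤ (hardInstance ε Lf β m₁ m₂ D).f₀ x := by
  have hm' : (0 : ℝ) < ((3 * m₁ * m₂ : ℕ) : ℝ) := by exact_mod_cast hm
  rw [hardInstance_f₀_eq β hD, ← Finset.mul_sum]
  have h1 : -(4 * Real.pi) * (D * ((3 * m₁ * m₂ : ℕ) : ℝ)) ≤ ∑ i : Fin (3 * m₁ * m₂),
      chain (weight m₁ m₂ D i) (scaledBlock ε Lf m₁ m₂ x i) := by
    have h2 : ∑ i : Fin (3 * m₁ * m₂), ∑ k ∈ Finset.range D, weight m₁ m₂ D i (k + 1) =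
        D * ((3 * m₁ * m₂ : ℕ) : ℝ) := by
      rw [Finset.sum_comm, Finset.sum_congr rfl fun k hk => sum_weight (Finset.mem_range.mp hk)]
      simp
    rw [← h2, Finset.mul_sum]
    exact Finset.sum_le_sum fun i _ => neg_weight_le_chain (weight_nonneg m₁ m₂ D i) _
  refine le_trans (le_of_eq ?_) (mul_le_mul_of_nonneg_left h1 (by positivity))
  field_simp
  ring

lemma hardInstance_f₀_zero_le {ε Lf : ℝ} (hLf : 0 < Lf) (β : ℝ) {m₁ m₂ D : ℕ} :
    (hardInstance ε Lf β m₁ m₂ D).f₀ 0 ≤ 0 := by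
  change ∑ i, fFun ε Lf m₁ m₂ i
    (fun j => (0 : EuclideanSpace ℝ (Fin (3 * m₁ * m₂) × Fin D)) (i, j)) ≤ 0
  refine Finset.sum_nonpos fun i _ => ?_
  unfold fFun
  refine mul_nonpos_of_nonneg_of_nonpos (by positivity) ?_
  refine le_of_eq_of_le ?_ (hFun_zero m₁ m₂ (D := D) i)
  congr 1
  funext j
  simp

lemma neg_le_iInf_F₀ {ε Lf β : ℝ} (hLf : 0 < Lf) (hβ : 0 ≤ β) {m₁ m₂ D : ℕ}
    (hm : 0 < 3 * m₁ * m₂) (hD : Odd D) :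
    ((-(1200 * Real.pi ^ 2 * ε ^ 2 * D / Lf) : ℝ) : EReal) ≤
      ⨅ x, (hardInstance ε Lf β m₁ m₂ D).F₀ x := by
  refine le_iInf fun x => ?_
  rw [hardInstance_F₀ hLf hm, EReal.coe_le_coe_iff]
  linarith [le_hardInstance_f₀ (ε := ε) hLf β hm hD x, hardReg_nonneg hβ x]

lemma gap_hardInstance {ε Lf β : ℝ} (hLf : 0 < Lf) (hβ : 0 ≤ β) {m₁ m₂ D : ℕ}
    (hm : 0 < 3 * m₁ * m₂) (hD : Odd D) :
    0 ≤ (hardInstance ε Lf β m₁ m₂ D).gap 0 ∧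
      (hardInstance ε Lf β m₁ m₂ D).gap 0 ≤ 1200 * Real.pi ^ 2 * ε ^ 2 * D / Lf := by
  have h1 := neg_le_iInf_F₀ (ε := ε) hLf hβ hm hD
  have h2 := iInf_le (hardInstance ε Lf β m₁ m₂ D).F₀ 0
  have h0 : (hardInstance ε Lf β m₁ m₂ D).f₀ 0 + hardReg β m₁ m₂ D 0 ≤ 0 := by
    have : hardReg β m₁ m₂ D 0 = 0 := by simp [hardReg]
    linarith [hardInstance_f₀_zero_le (ε := ε) hLf β (m₁ := m₁) (m₂ := m₂) (D := D)]
  unfold Problem.gap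
  rw [hardInstance_F₀ hLf hm] at h2 ⊢
  generalize ⨅ x, (hardInstance ε Lf β m₁ m₂ D).F₀ x = I at *
  induction I with
  | bot => simp at h1
  | top => exact absurd (top_le_iff.mp h2) (EReal.coe_ne_top _)
  | coe q =>
    rw [EReal.coe_le_coe_iff] at h1 h2
    rw [← EReal.coe_sub, EReal.toReal_coe]
    constructor <;> linarith

lemma callBound_hardInstance {ε Lf β : ℝ} (hε : 0 < ε) (hLf : 0 < Lf) (hβ : 0 ≤ β) {m₁ m₂ D : ℕ}
    (hm : 0 < 3 * m₁ * m₂) (hD : Odd D) (hD5 : 5 ≤ D) :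
    (hardInstance ε Lf β m₁ m₂ D).callBound ε Lf 0 ≤ (D - 2) * (m₁ * m₂) := by
  obtain ⟨hg0, hg⟩ := gap_hardInstance (ε := ε) hLf hβ hm hD
  have hκ := condNumber_le hLf hm (D := D)
  have hm' : (0 : ℝ) < ((3 * m₁ * m₂ : ℕ) : ℝ) := by exact_mod_cast hm
  have e : ((hardInstance ε Lf β m₁ m₂ D).callBound ε Lf 0) =
    ⌈condNumber (Matrix.fromRows (hardAbar Lf m₁ m₂ D) (hardA Lf m₁ m₂ D)) * Lf *
      (hardInstance ε Lf β m₁ m₂ D).gap 0 / (18000 * Real.pi ^ 2) * ε ^ (-2 : ℤ)⌉₊ := rfl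
  rw [e]
  refine Nat.ceil_le.mpr ?_
  have hπ := Real.pi_pos
  calc _ ≤ 2 * ((3 * m₁ * m₂ : ℕ) : ℝ) * Lf * (1200 * Real.pi ^ 2 * ε ^ 2 * D / Lf) /
        (18000 * Real.pi ^ 2) * ε ^ (-2 : ℤ) := by gcongr
    _ = 2 / 5 * D * (m₁ * m₂) := by
        rw [zpow_neg, show (2 : ℤ) = ((2 : ℕ) : ℤ) by rfl, zpow_natCast]
        push_cast
        field_simp
        ring
    -- `(2/5) D ≤ D - 2` holds since `5 ≤ D`.
    _ ≤ _ := by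
        push_cast [Nat.cast_sub (by omega : 2 ≤ D)]
        have : (5 : ℝ) ≤ D := by exact_mod_cast hD5
        exact mul_le_mul_of_nonneg_right (by linarith) (by positivity)

lemma inClass_hardInstance {ε Lf β : ℝ} (hε : 0 < ε) (hLf : 0 < Lf) (hβ : 0 ≤ β) {m₁ m₂ D : ℕ}
    (hm₁ : 0 < m₁) (hm₂ : 0 < m₂) (hD : Odd D) :
    (hardInstance ε Lf β m₁ m₂ D).InClass Lf := by
  have hm : 0 < 3 * m₁ * m₂ := by positivity
  have hm' : (0 : ℝ) < ((3 * m₁ * m₂ : ℕ) : ℝ) := by exact_mod_cast hm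
  set a : ℝ := β / (((3 * m₁ * m₂ : ℕ) : ℝ) * Lf) with ha
  have ha0 : 0 ≤ a := by positivity
  have hg : ∀ y, (hardInstance ε Lf β m₁ m₂ D).gbar y = ((a * ∑ k, |y k| : ℝ) : EReal) :=
    fun _ => rfl
  have hdom : effDom (hardInstance ε Lf β m₁ m₂ D).gbar = Set.univ := by
    ext y; simp only [effDom, Set.mem_ofPred_eq, hg, EReal.coe_lt_top, Set.mem_univ]
  refine ⟨?_, isSmoothWith_hardInstance hε hLf β hm hD, ⟨?_, ⟨0, ?_⟩, ?_, ?_⟩, ?_, ?_⟩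
  · exact (EReal.bot_lt_coe _).trans_le (neg_le_iInf_F₀ hLf hβ hm hD)
  · intro y; rw [hg]; exact EReal.coe_ne_bot _
  · rw [hg]; exact EReal.coe_ne_top _
  · have hc : Continuous fun y : EuclideanSpace ℝ (RowM m₁ m₂ × Fin D) =>
        ((a * ∑ k, |y k| : ℝ) : EReal) :=
      continuous_coe_real_ereal.comp (by fun_prop)
    exact hc.lowerSemicontinuous
  · intro p hp q hq s t hs ht hst
    simp only [Set.mem_ofPred_eq, hg, EReal.coe_le_coe_iff] at hp hq ⊢
    have h1 : ∑ k, |(s • p + t • q).1 k| ≤ s * ∑ k, |p.1 k| + t * ∑ k, |q.1 k| := by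
      rw [Finset.mul_sum, Finset.mul_sum, ← Finset.sum_add_distrib]
      refine Finset.sum_le_sum fun k _ => ?_
      refine (abs_add_le (s * p.1 k) (t * q.1 k)).trans (le_of_eq ?_)
      rw [abs_mul, abs_mul, abs_of_nonneg hs, abs_of_nonneg ht]
    have h2 := mul_le_mul_of_nonneg_left h1 ha0
    have h3 := mul_le_mul_of_nonneg_left hp hs
    have h4 := mul_le_mul_of_nonneg_left hq ht
    simp only [Prod.snd_add, Prod.smul_snd, smul_eq_mul]
    linarith
  · rw [hdom]
    exact ⟨0, interior_subset_intrinsicInterior (by simp)⟩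
  · rintro ⟨y, hy⟩
    rw [hdom] at hy
    -- The zero-based index `m₁ - 1` is the first row of `Ā`; a row must exist for the domain to
    -- have more than one point.
    have hr : m₁ - 1 < 3 * m₁ * m₂ - 1 := by
      have : m₁ ≤ m₁ * m₂ := Nat.le_mul_of_pos_right _ hm₂
      have : 3 * m₁ * m₂ = 3 * (m₁ * m₂) := by ring
      omega
    have k : RowM m₁ m₂ × Fin D :=
      (⟨⟨m₁ - 1, hr⟩, by simp only [Nat.sub_add_cancel hm₁, dvd_refl]⟩, ⟨0, hD.pos⟩)
    have h0 : (0 : EuclideanSpace ℝ (RowM m₁ m₂ × Fin D)) = y := by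
      have := Set.mem_univ (0 : EuclideanSpace ℝ (RowM m₁ m₂ × Fin D))
      rwa [hy] at this
    have h1 : EuclideanSpace.single k (1 : ℝ) = y := by
      have := Set.mem_univ (EuclideanSpace.single k (1 : ℝ))
      rwa [hy] at this
    have h2 := congrArg (fun v : EuclideanSpace ℝ (RowM m₁ m₂ × Fin D) => v k) (h1.trans h0.symm)
    simp at h2

/-! ## Propagation of nonzero coordinates -/

/-- A lower bound on the number of steps after which coordinate `k` of block `i` (both zero-based)
may be nonzero, when a third of the blocks has `M` elements. -/
def arrival (M i k : ℕ) : ℕ :=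
  if k = 0 then 0 else if Odd k then (k - 1) * M + (i + 1 - M) else (k - 1) * M + (2 * M - (i + 1))

lemma arrival_zero (M i : ℕ) : arrival M i 0 = 0 := by simp [arrival]

/-- With `arrival_le_succ`: adjacent blocks differ by at most one step, the price of a product with
`Aᵀ` or `Āᵀ`. -/
lemma arrival_succ_le (M i k : ℕ) : arrival M (i + 1) k ≤ arrival M i k + 1 := by
  unfold arrival; split_ifs <;> omega

lemma arrival_le_succ (M i k : ℕ) : arrival M i k ≤ arrival M (i + 1) k + 1 := by
  unfold arrival; split_ifs <;> omega

/-- Zero-based coordinate `k + 1` is created by link `k + 2`, in the first third if `k + 1` is odd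
and otherwise in the last. For `k > 0` its predecessor was created in the opposite third, so
reaching this block has already taken the `M` steps by which the formula increases. -/
lemma arrival_le_of_weight_ne_zero {m₁ m₂ D i k : ℕ} (h : weight m₁ m₂ D i (k + 2) ≠ 0) :
    arrival (m₁ * m₂) i (k + 1) ≤ arrival (m₁ * m₂) i k + 1 := by
  unfold weight at h
  rw [if_neg (show ¬ k + 2 = 1 by omega)] at h
  unfold arrival
  generalize m₁ * m₂ = M at *
  rw [if_neg (show ¬ k + 1 = 0 by omega), Nat.add_sub_cancel]
  have hpar : Even (k + 2) ↔ Odd (k + 1) := by grind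
  have hpar' : Odd k ↔ ¬ Odd (k + 1) := by grind
  simp only [hpar] at h
  rcases Nat.eq_zero_or_pos k with hk | hk
  · subst hk
    simp only [zero_add, odd_one, if_true] at h ⊢
    by_cases hi : i + 1 ≤ M
    · rw [zero_mul]; omega
    · simp [hi] at h
  · have e : k * M = (k - 1) * M + M := by
      obtain ⟨q, rfl⟩ : ∃ q, k = q + 1 := ⟨k - 1, by omega⟩
      rw [Nat.add_sub_cancel]; ring
    rw [if_neg (show ¬ k = 0 by omega), e]
    simp only [hpar']
    by_cases ho : Odd (k + 1)
    · simp only [ho, if_true, not_true_eq_false, if_false] at h ⊢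
      by_cases hi : i + 1 ≤ M
      · omega
      · simp [hi] at h
    · simp only [ho, if_false, not_false_eq_true, if_true] at h ⊢
      by_cases hi : 2 * M < i + 1
      · omega
      · simp [hi] at h

/-- The truncated distance is dropped, so the bound is uniform in the block. -/
lemma le_arrival {M D : ℕ} (hD : Odd D) (hD1 : 1 < D) (i : ℕ) :
    (D - 2) * M ≤ arrival M i (D - 1) := by
  have h : ¬ Odd (D - 1) := by grind
  unfold arrival
  rw [if_neg (by omega), if_neg h, Nat.sub_sub]
  exact Nat.le_add_right _ _

/-- The vectors whose nonzero coordinates have arrived by time `t`. -/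
def reached (M m D t : ℕ) : Submodule ℝ (EuclideanSpace ℝ (Fin m × Fin D)) where
  carrier := {x | ∀ (i : Fin m) (k : Fin D), t < arrival M i k → x (i, k) = 0}
  add_mem' := fun ha hb i k h => by simp [ha i k h, hb i k h]
  zero_mem' := fun _ _ _ => rfl
  smul_mem' := fun c x hx i k h => by simp [hx i k h]

/-- The vectors indexed by rows of `J` whose nonzero coordinates have arrived at one of the two
adjacent blocks by time `t`. -/
def reachedRows (M m D : ℕ) (p : Fin (m - 1) → Prop) (t : ℕ) :
    Submodule ℝ (EuclideanSpace ℝ ({r // p r} × Fin D)) where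
  carrier := {y | ∀ (r : {r // p r}) (k : Fin D),
    t < arrival M r.1 k → t < arrival M (r.1 + 1) k → y (r, k) = 0}
  add_mem' := fun ha hb i k h h' => by simp [ha i k h h', hb i k h h']
  zero_mem' := fun _ _ _ _ => rfl
  smul_mem' := fun c x hx i k h h' => by simp [hx i k h h']

lemma reached_mono {M m D s t : ℕ} (h : s ≤ t) : reached M m D s ≤ reached M m D t :=
  fun _ hx i k hk => hx i k (h.trans_lt hk)

lemma reachedRows_mono {M m D s t : ℕ} {p : Fin (m - 1) → Prop} (h : s ≤ t) :
    reachedRows M m D p s ≤ reachedRows M m D p t :=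
  fun _ hx i k hk hk' => hx i k (h.trans_lt hk) (h.trans_lt hk')

section Rows

variable {M m D t : ℕ} {c : ℝ} {p : Fin (m - 1) → Prop} [DecidablePred p]

/-- A row counts as reached once one adjacent block is, so this product is free and only the
transpose costs a step. -/
lemma mv_mem_reachedRows {x : EuclideanSpace ℝ (Fin m × Fin D)} (hx : x ∈ reached M m D t) :
    mv (blockRows c m D p) x ∈ reachedRows M m D p t := by
  intro r k h h'
  rw [mv_blockRows, hx (rightBlock r.1) k h', hx (leftBlock r.1) k h, sub_zero, mul_zero]

lemma mv_transpose_mem_reached {y : EuclideanSpace ℝ ({r // p r} × Fin D)}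
    (hy : y ∈ reachedRows M m D p t) : mv (blockRows c m D p)ᵀ y ∈ reached M m D (t + 1) := by
  intro i k h
  rw [mv_blockRows_transpose, Finset.sum_eq_zero, mul_zero]
  intro r _
  have h1 := arrival_succ_le M r.1 k
  have h2 := arrival_le_succ M r.1 k
  by_cases hi : (i : ℕ) = r.1
  · rw [hi] at h
    rw [hy r k (by omega) (by omega), mul_zero]
  · by_cases hi' : (i : ℕ) = r.1 + 1
    · rw [hi'] at h
      rw [hy r k (by omega) (by omega), mul_zero]
    · simp [J, hi, hi']

end Rows

/-- A gradient entry at a zero coordinate can only come from the link with its predecessor, which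
must be nonzero and joined by a link of nonzero weight. -/
lemma hardGrad_mem_reached {ε Lf : ℝ} {m₁ m₂ D t : ℕ}
    {x : EuclideanSpace ℝ (Fin (3 * m₁ * m₂) × Fin D)}
    (hx : x ∈ reached (m₁ * m₂) (3 * m₁ * m₂) D t) :
    hardGrad ε Lf m₁ m₂ x ∈ reached (m₁ * m₂) (3 * m₁ * m₂) D (t + 1) := by
  intro i k h
  have hz : ∀ j : Fin D, t < arrival (m₁ * m₂) i j →
      extCoord (scaledBlock ε Lf m₁ m₂ x i) (j + 1) = 0 := by
    intro j hj
    rw [extCoord_succ]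
    simp [scaledBlock, hx i j hj]
  have h1 : weight m₁ m₂ D i (k + 1) = 0 ∨ extCoord (scaledBlock ε Lf m₁ m₂ x i) k = 0 := by
    obtain ⟨k, hk⟩ := k
    cases k with
    | zero => rw [arrival_zero] at h; omega
    | succ k =>
      by_cases hw : weight m₁ m₂ D i (k + 2) = 0
      · exact Or.inl hw
      · have h3 := arrival_le_of_weight_ne_zero hw
        simp only at h
        exact Or.inr (hz ⟨k, by omega⟩ (by simp only; omega))
  change _ * chainDeriv _ _ _ = 0
  simp only [chainDeriv]
  rw [hz k (by omega), linkFst_zero_left]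
  rcases h1 with h1 | h1
  · rw [h1]; simp
  · rw [h1, linkSnd_zero_left]; simp

lemma mv_zero_mem {ι κ : Type} [Fintype ι] [Fintype κ] [DecidableEq ι]
    (S : Submodule ℝ (EuclideanSpace ℝ κ)) (B : Matrix κ ι ℝ) : mv B 0 ∈ S := by
  rw [mv, map_zero]; exact S.zero_mem

/-- The objective is separable: setting `p q` to zero does not increase the `ℓ¹` norm and lowers the
squared distance by `p q ^ 2`. -/
lemma eq_zero_of_isProx {κ : Type} [Fintype κ] [DecidableEq κ] {a η : ℝ} (ha : 0 ≤ a) (hη : 0 < η)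
    {ξ p : EuclideanSpace ℝ κ}
    (h : IsProx (fun y : EuclideanSpace ℝ κ => ((a * ∑ k, |y k| : ℝ) : EReal)) η ξ p) {q : κ}
    (hq : ξ q = 0) : p q = 0 := by
  set p' : EuclideanSpace ℝ κ := WithLp.toLp 2 fun k => if k = q then 0 else p k with hp'
  have h1 := h p'
  simp only [← EReal.coe_add, EReal.coe_le_coe_iff] at h1
  have h2 : ‖p' - ξ‖ ^ 2 = ‖p - ξ‖ ^ 2 - p q ^ 2 := by
    rw [EuclideanSpace.real_norm_sq_eq, EuclideanSpace.real_norm_sq_eq]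
    have e : ∀ k, (p' - ξ) k ^ 2 = (p - ξ) k ^ 2 - if k = q then p q ^ 2 else 0 := by
      intro k
      by_cases hk : k = q
      · subst hk; simp [hp', hq]
      · simp [hp', hk]
    rw [Finset.sum_congr rfl fun k _ => e k, Finset.sum_sub_distrib]
    simp
  have h3 : ∑ k, |p' k| ≤ ∑ k, |p k| := by
    refine Finset.sum_le_sum fun k _ => ?_
    simp only [hp']
    split_ifs <;> simp
  rw [h2] at h1
  have h4 := mul_le_mul_of_nonneg_left h3 ha
  have h5 : 0 < 1 / (2 * η) := by positivity
  have h6 : 1 / (2 * η) * p q ^ 2 ≤ 0 := by linarith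
  have h7 : p q ^ 2 ≤ 0 := by
    by_contra! hlt
    linarith [mul_pos h5 hlt]
  exact pow_eq_zero_iff two_ne_zero |>.mp (le_antisymm h7 (sq_nonneg _))

lemma prox_mem_reachedRows {ε Lf β η : ℝ} (hLf : 0 < Lf) (hβ : 0 ≤ β) (hη : 0 < η)
    {m₁ m₂ D M t : ℕ} {ξ p : EuclideanSpace ℝ (RowM m₁ m₂ × Fin D)}
    (hp : IsProx (hardInstance ε Lf β m₁ m₂ D).gbar η ξ p)
    (hξ : ξ ∈ reachedRows M (3 * m₁ * m₂) D (fun r => m₁ ∣ (r : ℕ) + 1) t) :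
    p ∈ reachedRows M (3 * m₁ * m₂) D (fun r => m₁ ∣ (r : ℕ) + 1) t :=
  fun r k h h' => eq_zero_of_isProx (by positivity) hη hp (hξ r k h h')

/-! ### Iterates of the method and their reach -/

section Algorithm

variable {ε Lf β : ℝ} {m₁ m₂ D : ℕ}
  {x : ℕ → EuclideanSpace ℝ (Fin (3 * m₁ * m₂) × Fin D)}
  {y : ℕ → EuclideanSpace ℝ (RowM m₁ m₂ × Fin D)}

/-- Iterates of the algorithm class, with one call per iteration. -/
lemma mem_reached_of_isAlgorithmClass2 (hε : 0 < ε) (hLf : 0 < Lf) (hβ : 0 ≤ β)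
    (hm : 0 < 3 * m₁ * m₂) (hD : Odd D) (hx0 : x 0 = 0) (hy0 : y 0 = 0)
    (h : (hardInstance ε Lf β m₁ m₂ D).IsAlgorithmClass2 x y) (t : ℕ) :
    x t ∈ reached (m₁ * m₂) (3 * m₁ * m₂) D t ∧
      y t ∈ reachedRows (m₁ * m₂) (3 * m₁ * m₂) D (fun r => m₁ ∣ (r : ℕ) + 1) t := by
  induction t using Nat.strong_induction_on with
  | _ t ih =>
  rcases Nat.eq_zero_or_pos t with ht | ht
  · rw [ht, hx0, hy0]; exact ⟨Submodule.zero_mem _, Submodule.zero_mem _⟩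
  obtain ⟨hx, η, ξ, p, hη, hξ, hp, hy⟩ := h t ht
  constructor
  · refine Submodule.span_le.mpr ?_ hx
    simp only [Set.iUnion_subset_iff]
    intro s hs
    obtain ⟨hxs, hys⟩ := ih s hs
    rintro v (rfl | rfl | rfl | rfl | rfl | rfl | rfl)
    · exact reached_mono hs.le hxs
    · rw [gradient_hardInstance hε hLf β hm hD]
      exact reached_mono hs (hardGrad_mem_reached hxs)
    · exact mv_zero_mem _ _
    · exact reached_mono hs (mv_transpose_mem_reached (mv_mem_reachedRows hxs))
    · exact mv_zero_mem _ _
    · exact reached_mono hs (mv_transpose_mem_reached (mv_mem_reachedRows hxs))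
    · exact reached_mono hs (mv_transpose_mem_reached hys)
  · have hξ' : ξ ∈ reachedRows (m₁ * m₂) (3 * m₁ * m₂) D (fun r => m₁ ∣ (r : ℕ) + 1) t := by
      refine Submodule.span_le.mpr ?_ hξ
      simp only [Set.iUnion_subset_iff]
      intro s hs
      obtain ⟨hxs, hys⟩ := ih s hs
      rintro v (rfl | rfl | rfl | rfl)
      · exact Submodule.zero_mem _
      · exact reachedRows_mono hs.le hys
      · exact reachedRows_mono hs (mv_mem_reachedRows (mv_transpose_mem_reached hys))
      · exact reachedRows_mono hs.le (mv_mem_reachedRows hxs)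
    refine Submodule.span_le.mpr ?_ hy
    rintro v (rfl | rfl)
    · exact hξ'
    · exact prox_mem_reachedRows hLf hβ hη hp hξ'

/-- Iterates computed from oracle calls, in terms of the number of calls. -/
lemma mem_reached_of_isComputedBy (hε : 0 < ε) (hLf : 0 < Lf) (hβ : 0 ≤ β)
    (hm : 0 < 3 * m₁ * m₂) (hD : Odd D) (hx0 : x 0 = 0) (hy0 : y 0 = 0)
    {c : ℕ → OracleCall (Fin (3 * m₁ * m₂) × Fin D) (RowMc m₁ m₂ × Fin D) (RowM m₁ m₂ × Fin D)}
    {N : ℕ → ℕ} (h : (hardInstance ε Lf β m₁ m₂ D).IsComputedBy x y c N) (t : ℕ) :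
    x t ∈ reached (m₁ * m₂) (3 * m₁ * m₂) D (N t) ∧
      y t ∈ reachedRows (m₁ * m₂) (3 * m₁ * m₂) D (fun r => m₁ ∣ (r : ℕ) + 1) (N t) := by
  obtain ⟨hc, hN, h⟩ := h
  induction t using Nat.strong_induction_on with
  | _ t ih =>
  rcases Nat.eq_zero_or_pos t with ht | ht
  · rw [ht, hx0, hy0]; exact ⟨Submodule.zero_mem _, Submodule.zero_mem _⟩
  obtain ⟨hx, ξ, hξ, hy⟩ := h t ht
  constructor
  · refine Submodule.span_le.mpr ?_ hx
    rintro v (((rfl | rfl) | ⟨s, hs, rfl⟩) | ⟨s, hs, k, hk, hkt, hv⟩)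
    · exact mv_zero_mem _ _
    · exact mv_zero_mem _ _
    · exact reached_mono (hN hs.le) (ih s hs).1
    · obtain ⟨hxs, hys⟩ := ih s hs
      -- The call `k` with `N s ≤ k < N t` pays for the one step that its answer may advance.
      have hlt : N s + 1 ≤ N t := by omega
      obtain ⟨h1, h2, h3, h4, h5, h6⟩ := hc k
      rcases hv with ⟨hq, rfl⟩ | ⟨hq, rfl⟩ | ⟨hq, rfl⟩ | ⟨hq, rfl⟩
      · rw [h1, hq, gradient_hardInstance hε hLf β hm hD]
        exact reached_mono hlt (hardGrad_mem_reached hxs)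
      · rw [h5, hq]
        exact reached_mono hlt (mv_transpose_mem_reached (mv_mem_reachedRows hxs))
      · rw [h4, hq]
        exact reached_mono hlt (mv_transpose_mem_reached (mv_mem_reachedRows hxs))
      · rw [h4, hq]
        exact reached_mono hlt (mv_transpose_mem_reached hys)
  · have hξ' : ξ ∈ reachedRows (m₁ * m₂) (3 * m₁ * m₂) D (fun r => m₁ ∣ (r : ℕ) + 1) (N t) := by
      refine Submodule.span_le.mpr ?_ hξ
      rintro v ((rfl | ⟨s, hs, rfl⟩) | ⟨s, hs, k, hk, hkt, hv⟩)
      · exact Submodule.zero_mem _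
      · exact reachedRows_mono (hN hs.le) (ih s hs).2
      · obtain ⟨hxs, hys⟩ := ih s hs
        have hlt : N s + 1 ≤ N t := by omega
        obtain ⟨h1, h2, h3, h4, h5, h6⟩ := hc k
        rcases hv with ⟨hq, rfl⟩ | ⟨hq, rfl⟩
        · rw [h2, hq]
          exact reachedRows_mono hlt (mv_mem_reachedRows (mv_transpose_mem_reached hys))
        · rw [h2, hq]
          exact reachedRows_mono (hN hs.le) (mv_mem_reachedRows hxs)
    rcases hy with hy | ⟨k, hk, hq, hy⟩
    · refine Submodule.span_le.mpr ?_ hy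
      rintro v rfl
      exact hξ'
    -- The prox call may be any earlier one, as the prox does not enlarge the set of reached rows.
    · refine Submodule.span_le.mpr ?_ hy
      rintro v (rfl | rfl)
      · exact hξ'
      · obtain ⟨-, -, -, -, -, h6⟩ := hc k
        rw [hq] at h6
        exact prox_mem_reachedRows hLf hβ (c k).η_pos h6 hξ'

end Algorithm

/-- A vector near a stationary point has not been reached before the bound. -/
lemma callBound_le_of_mem_reached {ε Lf ω β : ℝ} (hε : 0 < ε) (hLf : 0 < Lf) (hω : 0 ≤ ω)
    (hω' : ω < 150 * Real.pi * ε / Lf) {m₁ m₂ D : ℕ} (hm : 0 < 3 * m₁ * m₂) (hD5 : 5 ≤ D)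
    (hD : Odd D) (hβ : (50 * Real.pi + 1) * √((3 * m₁ * m₂ : ℕ) : ℝ) * ε < β)
    {x xs : EuclideanSpace ℝ (Fin (3 * m₁ * m₂) × Fin D)}
    (hxs : (hardInstance ε Lf β m₁ m₂ D).IsStationary ε xs) (hdist : ‖x - xs‖ ≤ ω) {t : ℕ}
    (hx : x ∈ reached (m₁ * m₂) (3 * m₁ * m₂) D t) :
    (hardInstance ε Lf β m₁ m₂ D).callBound ε Lf 0 ≤ t := by
  by_contra! hlt
  have hβ0 : 0 ≤ β := le_trans (by positivity) hβ.le
  have hm' : (0 : ℝ) < ((3 * m₁ * m₂ : ℕ) : ℝ) := by exact_mod_cast hm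
  have hπ := Real.pi_pos
  have hbound := callBound_hardInstance hε hLf hβ0 hm hD hD5
  set k : Fin D := ⟨D - 1, by omega⟩ with hk
  have hzero : ∀ i, x (i, k) = 0 := fun i =>
    hx i k (by have := le_arrival (M := m₁ * m₂) hD (by omega) (i : ℕ); simp only [hk]; omega)
  have hlarge : ∀ i, 1 ≤ scale ε Lf m₁ m₂ ^ 2 * xs (i, k) ^ 2 := by
    intro i
    have h1 := one_le_abs_of_isStationary hε hLf hm hD hβ hxs i k
    rw [← mul_pow, ← sq_abs]
    exact one_le_pow₀ h1
  have hsum : ∑ i, xs (i, k) ^ 2 ≤ ω ^ 2 := by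
    calc ∑ i, xs (i, k) ^ 2 = ∑ i, (x - xs) (i, k) ^ 2 :=
          Finset.sum_congr rfl fun i _ => by simp [hzero]
      _ ≤ ‖x - xs‖ ^ 2 := by
          rw [EuclideanSpace.real_norm_sq_eq, Fintype.sum_prod_type_right]
          exact Finset.single_le_sum (f := fun k : Fin D => ∑ i, (x - xs) (i, k) ^ 2)
            (fun _ _ => Finset.sum_nonneg fun _ _ => sq_nonneg _) (Finset.mem_univ k)
      _ ≤ ω ^ 2 := pow_le_pow_left₀ (norm_nonneg _) hdist 2
  -- Each of the `m` blocks contributes at least `1`. By the value of `scale` this amounts to `ω Lf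
  -- ≥ 150πε`, against `hω'`.
  have h1 : ((3 * m₁ * m₂ : ℕ) : ℝ) ≤ scale ε Lf m₁ m₂ ^ 2 * ω ^ 2 := by
    refine le_trans ?_ (mul_le_mul_of_nonneg_left hsum (sq_nonneg _))
    rw [Finset.mul_sum]
    refine le_trans (le_of_eq ?_) (Finset.sum_le_sum fun i _ => hlarge i)
    simp
  have h2 : ω * Lf < 150 * Real.pi * ε := (lt_div_iff₀ hLf).mp hω'
  have h3 : (ω * Lf) ^ 2 < (150 * Real.pi * ε) ^ 2 :=
    pow_lt_pow_left₀ h2 (by positivity) two_ne_zero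
  unfold scale at h1
  rw [div_pow, mul_pow, Real.sq_sqrt hm'.le, div_mul_eq_mul_div, le_div_iff₀ (by positivity)] at h1
  nlinarith [mul_lt_mul_of_pos_left h3 hm']

end

end AffineComposite

/-- Lower bound on the number of oracle calls that a first-order method needs on the instance `𝒫`
to come `ω`-close to an `ε`-stationary point of it. The bound holds for the index `t` of the
iterate (one call per iteration), and for the number `N t` of calls in any implementation of the
method through calls to the oracle. -/
theorem corollary1 (ε Lf ω : ℝ) (hε : 0 < ε) (hLf : 0 < Lf) (hω : 0 ≤ ω)
    (hω' : ω < 150 * Real.pi * ε / Lf)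
    (m₁ m₂ D : ℕ) (hm₁ : 2 ≤ m₁) (hm₂ : 1 ≤ m₂) (hm : Even (m₁ * m₂)) (hD : 5 ≤ D) (hDodd : Odd D)
    (β : ℝ)
    (hβ : (50 * Real.pi + 1 + AffineComposite.specNorm (AffineComposite.hardA Lf m₁ m₂ D)) *
      √((3 * m₁ * m₂ : ℕ) : ℝ) * ε < β)
    (P : AffineComposite.Problem (Fin (3 * m₁ * m₂) × Fin D) (AffineComposite.RowMc m₁ m₂ × Fin D)
      (AffineComposite.RowM m₁ m₂ × Fin D))
    (hP : P = AffineComposite.hardInstance ε Lf β m₁ m₂ D) :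
    P.InClass Lf ∧
    ∀ (x : ℕ → EuclideanSpace ℝ (Fin (3 * m₁ * m₂) × Fin D))
      (y : ℕ → EuclideanSpace ℝ (AffineComposite.RowM m₁ m₂ × Fin D)),
      x 0 = 0 → y 0 = 0 → P.IsAlgorithmClass2 x y →
      ∀ (t : ℕ) (xs : EuclideanSpace ℝ (Fin (3 * m₁ * m₂) × Fin D)),
        P.IsStationary ε xs → ‖x t - xs‖ ≤ ω →
        P.callBound ε Lf (x 0) ≤ t ∧
        ∀ (c : ℕ → AffineComposite.OracleCall (Fin (3 * m₁ * m₂) × Fin D)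
            (AffineComposite.RowMc m₁ m₂ × Fin D) (AffineComposite.RowM m₁ m₂ × Fin D))
          (N : ℕ → ℕ),
          P.IsComputedBy x y c N → P.callBound ε Lf (x 0) ≤ N t := by
  subst hP
  have hm : 0 < 3 * m₁ * m₂ := by positivity
  have hβ' : (50 * Real.pi + 1) * √((3 * m₁ * m₂ : ℕ) : ℝ) * ε < β := by
    refine lt_of_le_of_lt ?_ hβ
    have h : 0 ≤ AffineComposite.specNorm (AffineComposite.hardA Lf m₁ m₂ D) := norm_nonneg _
    exact mul_le_mul_of_nonneg_right (mul_le_mul_of_nonneg_right (by linarith) (Real.sqrt_nonneg _))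
      hε.le
  have hβ0 : 0 ≤ β := le_trans (by positivity) hβ'.le
  refine ⟨AffineComposite.inClass_hardInstance hε hLf hβ0 (by omega) (by omega) hDodd, ?_⟩
  intro x y hx0 hy0 halg t xs hxs hdist
  rw [hx0]
  refine ⟨?_, fun c N hc => ?_⟩
  · exact AffineComposite.callBound_le_of_mem_reached hε hLf hω hω' hm hD hDodd hβ' hxs hdist
      (AffineComposite.mem_reached_of_isAlgorithmClass2 hε hLf hβ0 hm hDodd hx0 hy0 halg t).1
  · exact AffineComposite.callBound_le_of_mem_reached hε hLf hω hω' hm hD hDodd hβ' hxs hdist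
      (AffineComposite.mem_reached_of_isComputedBy hε hLf hβ0 hm hDodd hx0 hy0 hc t).1
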